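/- Throughout, $\log$ is the logarithm to base $2$ and $[n]=\{1,\dots,n\}$. For a real number $r$, a function $f:[n]\to[n]$ is called $r$-non-injective if some $b\in[n]$ has at least $r$ preimages under $f$. Let $C_\star$ be any constant such that, for every positive integer $n$, a uniformly random function $f:[n]\to[n]$ is $C_\star(1+\log n)$-non-injective with probability at most $1/(2n^2)$. Limited Pointer Chasing Equality $\mathrm{LPCE}_{n,p,r}$ is the following communication problem in the blackboard model with $2p$ players $P_1,\dots,P_{2p}$. For $1\le i\le p$, player $P_i$ holds a function $f_i:[n]\to[n]$ and player $P_{p+i}$ holds a function $g_i:[n]\to[n]$. The players speak in $p-1$ rounds, in each round in the order $P_1,\dots,P_{2p}$; every message is a finite bit string seen by all players, and in the last turn of the last round $P_{2p}$, instead of sending a message, outputs one bit (for $p=1$ no message is sent and $P_2$ outputs the bit right away). The correct output is $1$ if one of the functions $f_1,\dots,f_p,g_1,\dots,g_p$ is $r$-non-injective or if $f_1(f_2(\cdots f_p(1)\cdots))=g_1(g_2(\cdots g_p(1)\cdots))$, and it is $0$ otherwise. In a private-randomness protocol the messages and the output of a player depend only on the player's own input, the player's own private random bits, and the messages sent so far.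 The information cost of such a protocol $\Pi$ on an input distribution $\psi$ is the mutual information $I(X;\Pi(X))$ in bits, where $X$ is drawn from $\psi$ and the transcript $\Pi(X)$ is the sequence of all messages sent on input $X$. The information complexity $\mathrm{IC}_{\psi,\delta}$ of a problem is the infimum of the information cost on $\psi$ over all private-randomness protocols for it that err with probability at most $\delta$ on every input (it is $+\infty$ if there is no such protocol). Let $n$ and $p$ be positive integers with $n\ge 18p^2$, and let $\mu$ be the uniform distribution on all inputs $(f_1,\dots,f_p,g_1,\dots,g_p)$. Then $$\mathrm{IC}_{\mu,1/(64n)}\bigl(\mathrm{LPCE}_{n,p,C_\star(1+\log n)}\bigr)\ \ge\ \frac{n}{2^{29}\cdot 3^5\cdot p^{16}}-\frac{\lceil 2\log n\rceil}{2^{13}\cdot 3^2\cdot p^8}-2 .$$ The same lower bound holds if the infimum is taken over all private-randomness protocols whose error probability on a random input drawn from $\mu$ is at most $1/(64n)$. Moreover, there are absolute constants $c,K>0$ such that, for all positive integers $n,p$ with $n\ge 18p^2$, the right-hand side is at least $c\,\frac{n}{p^{16}}-K\left(\frac{\log n}{p^8}+1\right)$. -/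

import Mathlib

open scoped ENNReal

/-- A message written on the blackboard: a finite bit string. -/
abbrev Message : Type := List Bool

/-- The content of the blackboard: the messages sent so far, in chronological order. -/
abbrev Board : Type := List Message

/-- A private-randomness blackboard protocol with `k` players, each holding an input in `X`, in which
the last player finally outputs an element of `Y`.  Whenever player `j` speaks, the message is drawn
from a distribution that depends only on `j`, on the input of player `j` and on the board; draws in
different turns use independent randomness.  (Since the players' inputs are fixed and their private
coins are independent, the coins of the players stay independent given the board, so letting a player
reuse private coins of earlier turns gives the same joint laws of transcripts and outputs.) -/
structure PrivateCoinProtocol (k : ℕ) (X Y : Type) where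
  /-- The law of the message of a player, given the player's input and the board. -/
  message : Fin k → X → Board → PMF Message
  /-- The law of the output of the last player, given that player's input and the board. -/
  output : X → Board → PMF Y

namespace PrivateCoinProtocol

variable {k : ℕ} [NeZero k] {X Y : Type}

/-- The last of the `k` players. -/
def lastPlayer (k : ℕ) [NeZero k] : Fin k := ⟨k - 1, Nat.sub_lt (NeZero.pos k) Nat.one_pos⟩

/-- The players speak cyclically, in the order `0, 1, …, k - 1`; `speaker k t` is the player that sends
message number `t` (counted from `0`). -/
def speaker (k : ℕ) [NeZero k] (t : ℕ) : Fin k := ⟨t % k, Nat.mod_lt t (NeZero.pos k)⟩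

/-- The law of the first `t` messages on input `x`. -/
noncomputable def boardDist (P : PrivateCoinProtocol k X Y) (x : Fin k → X) : ℕ → PMF Board
  | 0 => PMF.pure []
  | t + 1 => (P.boardDist x t).bind fun h =>
      (P.message (speaker k t) (x (speaker k t)) h).map fun m => h ++ [m]

/-- The law of the transcript of the protocol run for `r` rounds on input `x`.  There are `k * r` turns;
in the last one the last player does not send a message but outputs the solution, so the transcript
consists of `k * r - 1` messages (of no message if `r = 0`). -/
noncomputable def transcriptDist (P : PrivateCoinProtocol k X Y) (r : ℕ) (x : Fin k → X) : PMF Board :=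
  P.boardDist x (k * r - 1)

/-- The law of the output of the protocol run for `r` rounds on input `x`. -/
noncomputable def outputDist (P : PrivateCoinProtocol k X Y) (r : ℕ) (x : Fin k → X) : PMF Y :=
  (P.transcriptDist r x).bind fun h => P.output (x (lastPlayer k)) h

/-- The probability that the `r`-round protocol errs on input `x`, the correct answer being `F x`. -/
noncomputable def errorProb (P : PrivateCoinProtocol k X Y) (r : ℕ) (F : (Fin k → X) → Y)
    (x : Fin k → X) : ℝ≥0∞ :=
  (P.outputDist r x).toOuterMeasure {y | y ≠ F x}

/-- The probability that the `r`-round protocol errs on a random input drawn from `ψ`. -/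
noncomputable def avgErrorProb (P : PrivateCoinProtocol k X Y) (r : ℕ) (F : (Fin k → X) → Y)
    (ψ : PMF (Fin k → X)) : ℝ≥0∞ :=
  ∑' x, ψ x * P.errorProb r F x

end PrivateCoinProtocol

/-- The mutual information `I(A; B)`, in bits, of two discrete random variables with joint law `J`: the
Kullback-Leibler divergence of the joint law from the product of its marginals (Mathlib's `klDiv` is
in nats). -/
noncomputable def mutualInformation {α β : Type} (J : PMF (α × β)) : ℝ≥0∞ :=
  letI : MeasurableSpace α := ⊤
  letI : MeasurableSpace β := ⊤
  InformationTheory.klDiv J.toMeasure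
    ((J.map Prod.fst).toMeasure.prod (J.map Prod.snd).toMeasure) / ENNReal.ofReal (Real.log 2)

section InformationComplexity

variable {k : ℕ} [NeZero k] {X Y : Type}

/-- The (external) information cost `I(X; Π(X))` of an `r`-round protocol `Π` on the input
distribution `ψ`. -/
noncomputable def PrivateCoinProtocol.informationCost (P : PrivateCoinProtocol k X Y) (r : ℕ)
    (ψ : PMF (Fin k → X)) : ℝ≥0∞ :=
  mutualInformation (ψ.bind fun x => (P.transcriptDist r x).map fun h => (x, h))

/-- The information complexity on `ψ` of the problem of computing `F` in `r` rounds with error `δ`: the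
infimum of the information cost over all private-randomness protocols that err with probability at most
`δ` on every input.  It is `∞` if there is no such protocol. -/
noncomputable def informationComplexity (r : ℕ) (F : (Fin k → X) → Y) (ψ : PMF (Fin k → X))
    (δ : ℝ≥0∞) : ℝ≥0∞ :=
  ⨅ (P : PrivateCoinProtocol k X Y) (_ : ∀ x, P.errorProb r F x ≤ δ), P.informationCost r ψ

/-- The distributional variant: the infimum of the information cost over all private-randomness protocols
that err with probability at most `δ` on a random input drawn from `ψ`. -/
noncomputable def distInformationComplexity (r : ℕ) (F : (Fin k → X) → Y) (ψ : PMF (Fin k → X))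
    (δ : ℝ≥0∞) : ℝ≥0∞ :=
  ⨅ (P : PrivateCoinProtocol k X Y) (_ : P.avgErrorProb r F ψ ≤ δ), P.informationCost r ψ

end InformationComplexity

/-- `f` is `r`-non-injective: some `r` points have the same image.  For a real number `r` this means
"at least `r` points", that is, `⌈r⌉` points. -/
def IsNonInjective {A B : Type} (r : ℝ) (f : A → B) : Prop :=
  ∃ (S : Finset A) (b : B), r ≤ (S.card : ℝ) ∧ ∀ a ∈ S, f a = b

/-- The defining property of the constant `C⋆`: for every positive integer `n`, a uniformly random
function `[n] → [n]` is `C (1 + log n)`-non-injective with probability at most `1 / (2 n ^ 2)`. -/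
def IsNonInjectivityConstant (C : ℝ) : Prop :=
  ∀ n : ℕ, 0 < n →
    (Nat.card {f : Fin n → Fin n // IsNonInjective (C * (1 + Real.logb 2 n)) f} : ℝ)
      / (Nat.card (Fin n → Fin n) : ℝ) ≤ 1 / (2 * (n : ℝ) ^ 2)

/-- Pointer chasing: `f₁ (f₂ (… (f_p 1) …))`.  The element `1` of `[n]` is `0 : Fin n`. -/
def pointerChasing {n p : ℕ} [NeZero n] (f : Fin p → Fin n → Fin n) : Fin n :=
  (List.ofFn f).foldr (fun g a => g a) 0

/-- The functions `f₁, …, f_p` held by the first `p` of the `2 p` players. -/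
def firstHalf {A : Type} {p : ℕ} (x : Fin (2 * p) → A) : Fin p → A :=
  fun i => x ⟨i, by omega⟩

/-- The functions `g₁, …, g_p` held by the last `p` of the `2 p` players. -/
def secondHalf {A : Type} {p : ℕ} (x : Fin (2 * p) → A) : Fin p → A :=
  fun i => x ⟨p + i, by omega⟩

open Classical in
/-- The correct answer of limited pointer chasing equality `LPCE_{n,p,r}`, where the players hold the
functions `x 0 = f₁, …, x (p - 1) = f_p, x p = g₁, …, x (2 p - 1) = g_p`. -/
noncomputable def lpce (n p : ℕ) [NeZero n] (r : ℝ) (x : Fin (2 * p) → Fin n → Fin n) : Bool :=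
  decide ((∃ j, IsNonInjective r (x j)) ∨
    pointerChasing (firstHalf x) = pointerChasing (secondHalf x))

/-!
Fix a protocol of small information cost that runs for `p - 1` rounds, on uniform inputs. The input
prior is a product and the players use private coins, so the probability of a board factors over the
players (`PrivateCoinProtocol.tsum_boardDist_mul`), and given the board the inputs of the players
are independent.

*Information.* By the Donsker–Varadhan bound for the Kullback–Leibler divergence
(`lintegral_le_klDiv_add_lintegral`), applied to a test function that counts the points `a` at which
`f i a` takes a value that is too rare given the board, an information cost of at most
`n / (64 p ^ 2)` forces, for each player `i`, the conditional law of `f i a` given the board to be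
within `1 / (4 p)` of uniform in total variation, on average over `a` and over the board
(`inv_mul_sum_deficit_le`).

*Round elimination.* In each round the players of a half speak in the order opposite to that of the
chase. Hence between the moment at which the `j`-th pointer is still unknown and the corresponding
moment one round later, the player who holds the next function is silent. The law of this function given
the board does not change meanwhile, and it is independent of the `j`-th pointer. So the distance
from uniform of the next pointer exceeds that of the `j`-th one by at most the average distance of
the values of the next function (`chaseDeficit_le`, `deficit_chasedPointer_le`). After `p - 1` rounds
the last pointer of either half is within `1 / 4` of uniform.

*Equality.* Given the board the two last pointers `F` and `G` are independent, and both are near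
uniform. Thus `F = G` has probability at most about `1 / n + 1 / 4`, and since non-injective functions
are rare, a protocol with few errors seldom answers `1`. But then it answers `0` on the event `F = G`
with probability at least a constant times `1 / n`
(`one_div_le_unifAvg_eq_answerProb`), which contradicts an error of at most `1 / (64 n)`. This proves a
lower bound of `n / (64 p ^ 2)` for the information cost, which exceeds the claimed one.

All probabilities are elements of `[0, ∞]`, and total variation distances are written as sums of
truncated differences, so that no question of summability over the infinitely many boards arises.
-/

/-! ### Uniform averages -/

section Averages

variable {Ω : Type*} [Fintype Ω]

/-- The average of a function with values in `[0, ∞]` over a finite type. -/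
noncomputable def unifAvg (F : Ω → ℝ≥0∞) : ℝ≥0∞ := (Fintype.card Ω : ℝ≥0∞)⁻¹ * ∑ x, F x

lemma unifAvg_mono {F G : Ω → ℝ≥0∞} (h : ∀ x, F x ≤ G x) : unifAvg F ≤ unifAvg G :=
  mul_le_mul_right (Finset.sum_le_sum fun x _ => h x) _

lemma unifAvg_add (F G : Ω → ℝ≥0∞) :
    unifAvg (fun x => F x + G x) = unifAvg F + unifAvg G := by
  simp [unifAvg, Finset.sum_add_distrib, mul_add]

lemma unifAvg_sum {ι : Type*} (s : Finset ι) (F : ι → Ω → ℝ≥0∞) :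
    unifAvg (fun x => ∑ i ∈ s, F i x) = ∑ i ∈ s, unifAvg (F i) := by
  simp only [unifAvg, ← Finset.mul_sum]
  rw [Finset.sum_comm]

lemma unifAvg_tsum {ι : Type*} (F : ι → Ω → ℝ≥0∞) :
    unifAvg (fun x => ∑' i, F i x) = ∑' i, unifAvg (F i) := by
  simp only [unifAvg, ENNReal.tsum_mul_left]
  rw [Summable.tsum_finsetSum fun _ _ => ENNReal.summable]

lemma unifAvg_const_mul (c : ℝ≥0∞) (F : Ω → ℝ≥0∞) :
    unifAvg (fun x => c * F x) = c * unifAvg F := by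
  simp only [unifAvg, ← Finset.mul_sum]
  ring

lemma unifAvg_mul_const (c : ℝ≥0∞) (F : Ω → ℝ≥0∞) :
    unifAvg (fun x => F x * c) = unifAvg F * c := by
  simp only [mul_comm _ c, unifAvg_const_mul]

lemma unifAvg_const [Nonempty Ω] (c : ℝ≥0∞) : unifAvg (fun _ : Ω => c) = c := by
  simp only [unifAvg, Finset.sum_const, Finset.card_univ, nsmul_eq_mul]
  rw [← mul_assoc, ENNReal.inv_mul_cancel (by simp) (by simp), one_mul]

lemma unifAvg_le_one [Nonempty Ω] {F : Ω → ℝ≥0∞} (h : ∀ x, F x ≤ 1) : unifAvg F ≤ 1 :=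
  (unifAvg_mono h).trans_eq (unifAvg_const 1)

lemma unifAvg_eq_tsum_uniformOfFintype [Nonempty Ω] (F : Ω → ℝ≥0∞) :
    ∑' x, PMF.uniformOfFintype Ω x * F x = unifAvg F := by
  simp [unifAvg, tsum_fintype, Finset.mul_sum]

lemma unifAvg_pi_prod {ι β : Type*} [Fintype ι] [DecidableEq ι] [Fintype β]
    (g : ι → β → ℝ≥0∞) :
    unifAvg (fun y : ι → β => ∏ i, g i (y i)) = ∏ i, unifAvg (g i) := by
  simp only [unifAvg, Finset.prod_mul_distrib, Finset.prod_const, Finset.card_univ,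
    Fintype.card_fun, Nat.cast_pow, ENNReal.inv_pow]
  rw [Finset.prod_univ_sum]
  simp

/-- Under the uniform distribution on a product, each coordinate is uniform. -/
lemma unifAvg_apply {ι β : Type*} [Fintype ι] [DecidableEq ι] [Fintype β] [Nonempty β]
    (i : ι) (g : β → ℝ≥0∞) :
    unifAvg (fun y : ι → β => g (y i)) = unifAvg g := by
  have h := unifAvg_pi_prod (fun j b => if j = i then g b else 1)
  simp only [Finset.prod_ite_eq', Finset.mem_univ, if_true] at h
  rw [h, Finset.prod_eq_single i]
  · simp
  · intro j _ hj
    simp [hj, unifAvg_const]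
  · simp

/-- Under the uniform distribution on a product, functions of disjoint sets of coordinates are
independent. -/
lemma unifAvg_mul_of_dependsOn {ι β : Type*} [Fintype ι] [DecidableEq ι] [Fintype β] [Nonempty β]
    {F G : (ι → β) → ℝ≥0∞} {S : Set ι} (hF : DependsOn F S) (hG : DependsOn G Sᶜ) :
    unifAvg (fun x => F x * G x) = unifAvg F * unifAvg G := by
  classical
  -- Exchanging the coordinates outside `S` between two points is an involution on pairs.
  let e : (ι → β) × (ι → β) → (ι → β) × (ι → β) :=
    fun z => (S.piecewise z.1 z.2, S.piecewise z.2 z.1)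
  have he : Function.Involutive e := by
    rintro ⟨x, y⟩
    ext i <;> by_cases hi : i ∈ S <;> simp [e, hi]
  have key : ∑ z : (ι → β) × (ι → β), F z.1 * G z.2
      = ∑ z : (ι → β) × (ι → β), F z.1 * G z.1 := by
    refine Fintype.sum_equiv he.toPerm _ _ fun z => ?_
    have h1 : F (S.piecewise z.1 z.2) = F z.1 := hF fun i hi => by simp [hi]
    have h2 : G (S.piecewise z.1 z.2) = G z.2 := hG fun i hi => by
      simp [(Set.mem_compl_iff S i).1 hi]
    simp [e, h1, h2]
  have h3 : (∑ x, F x) * ∑ y, G y = (Fintype.card (ι → β) : ℝ≥0∞) * ∑ x, F x * G x := by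
    rw [Fintype.sum_mul_sum, ← Fintype.sum_prod_type', key, Fintype.sum_prod_type]
    simp [Finset.sum_const, Finset.mul_sum]
  have hc : (Fintype.card (ι → β) : ℝ≥0∞)⁻¹ * Fintype.card (ι → β) = 1 :=
    ENNReal.inv_mul_cancel (by simp) (by simp)
  calc unifAvg (fun x => F x * G x)
      = (Fintype.card (ι → β) : ℝ≥0∞)⁻¹ * (((Fintype.card (ι → β) : ℝ≥0∞)⁻¹ *
          Fintype.card (ι → β)) * ∑ x, F x * G x) := by rw [hc, one_mul, unifAvg]
    _ = (Fintype.card (ι → β) : ℝ≥0∞)⁻¹ * ((Fintype.card (ι → β) : ℝ≥0∞)⁻¹ *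
          ((∑ x, F x) * ∑ y, G y)) := by rw [h3]; ring
    _ = unifAvg F * unifAvg G := by rw [unifAvg, unifAvg]; ring

lemma unifAvg_ite_eq_one_div {n : ℕ} (v : Fin n) :
    unifAvg (fun u : Fin n => if u = v then (1 : ℝ≥0∞) else 0) = 1 / n := by
  simp [unifAvg]

lemma sum_const_div {n : ℕ} [NeZero n] (c : ℝ≥0∞) : ∑ _v : Fin n, c / n = c := by
  simp only [Finset.sum_const, Finset.card_univ, Fintype.card_fin, nsmul_eq_mul]
  exact ENNReal.mul_div_cancel (by simp [NeZero.ne n]) (by simp)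

/-- The mass missing from a distribution on `[n]` equals the mass in excess. -/
lemma sum_tsub_div_eq {n : ℕ} [NeZero n] {b : Fin n → ℝ≥0∞} (hb : ∑ a, b a ≠ ⊤) :
    ∑ a, (b a - (∑ c, b c) / n) = ∑ a, ((∑ c, b c) / n - b a) := by
  set B := ∑ c, b c with hB
  have h : ∑ a, (b a - B / n) + ∑ _a : Fin n, B / n = ∑ a, (B / n - b a) + ∑ a, b a := by
    rw [← Finset.sum_add_distrib, ← Finset.sum_add_distrib]
    refine Finset.sum_congr rfl fun a _ => ?_
    rw [tsub_add_eq_max, tsub_add_eq_max, max_comm]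
  rw [sum_const_div, ← hB] at h
  exact (ENNReal.add_left_inj hb).1 h

lemma dependsOn_compl_of_isCompl {k : ℕ} {X α : Type} {S T : Finset (Fin k)} (h : IsCompl S T)
    {F : (Fin k → X) → α} (hF : DependsOn F (T : Set (Fin k))) :
    DependsOn F (S : Set (Fin k))ᶜ := by
  rwa [← Finset.coe_compl, h.compl_eq]

lemma dependsOn_apply {k n : ℕ} (i : Fin k) (a : Fin n) :
    DependsOn (fun x : Fin k → Fin n → Fin n => x i a) (({i} : Finset (Fin k)) : Set (Fin k)) := by
  intro x y h
  simp only [h i (by simp)]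

end Averages

/-! ### Variational bounds for the divergence -/

section Divergence

open MeasureTheory InformationTheory

/-- The Fenchel–Young inequality for `u log u + 1 - u`, whose convex conjugate is `exp c - 1`. -/
lemma mul_add_one_le_klFun_add_exp {u : ℝ} (hu : 0 ≤ u) (c : ℝ) :
    u * c + 1 ≤ klFun u + Real.exp c := by
  rcases hu.eq_or_lt with rfl | hu
  · simp [klFun_zero, Real.exp_nonneg]
  · have h := Real.add_one_le_exp (c - Real.log u)
    rw [Real.exp_sub, Real.exp_log hu, le_div_iff₀ hu] at h
    rw [klFun_apply]
    nlinarith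

/-- The Donsker–Varadhan lower bound for the Kullback–Leibler divergence, with the test function
`A - B` split into two nonnegative parts. -/
lemma lintegral_le_klDiv_add_lintegral {Ω : Type*} [MeasurableSpace Ω] (μ ν : Measure Ω)
    [IsProbabilityMeasure μ] [IsProbabilityMeasure ν] {A B : Ω → ℝ} (hA : Measurable A)
    (hB : Measurable B) (hA0 : ∀ ω, 0 ≤ A ω) (hB0 : ∀ ω, 0 ≤ B ω)
    (hexp : ∫⁻ ω, ENNReal.ofReal (Real.exp (A ω - B ω)) ∂ν ≤ 1) :
    ∫⁻ ω, ENNReal.ofReal (A ω) ∂μ ≤ klDiv μ ν + ∫⁻ ω, ENNReal.ofReal (B ω) ∂μ := by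
  by_cases hac : μ ≪ ν
  swap
  · simp [klDiv_of_not_ac hac]
  have hpt : ∀ᵐ ω ∂ν, μ.rnDeriv ν ω * ENNReal.ofReal (A ω) + 1
      ≤ (ENNReal.ofReal (klFun (μ.rnDeriv ν ω).toReal) + μ.rnDeriv ν ω * ENNReal.ofReal (B ω))
        + ENNReal.ofReal (Real.exp (A ω - B ω)) := by
    filter_upwards [Measure.rnDeriv_ne_top μ ν] with ω hω
    have hu : 0 ≤ (μ.rnDeriv ν ω).toReal := ENNReal.toReal_nonneg
    set u := (μ.rnDeriv ν ω).toReal with hudef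
    have h := mul_add_one_le_klFun_add_exp hu (A ω - B ω)
    have hk := klFun_nonneg hu
    have h1 : μ.rnDeriv ν ω = ENNReal.ofReal u := (ENNReal.ofReal_toReal hω).symm
    rw [h1, ← ENNReal.ofReal_mul hu, ← ENNReal.ofReal_mul hu, ← ENNReal.ofReal_one,
      ← ENNReal.ofReal_add (mul_nonneg hu (hA0 ω)) zero_le_one,
      ← ENNReal.ofReal_add hk (mul_nonneg hu (hB0 ω)),
      ← ENNReal.ofReal_add (add_nonneg hk (mul_nonneg hu (hB0 ω))) (Real.exp_nonneg _)]
    exact ENNReal.ofReal_le_ofReal (by linarith)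
  have hint := lintegral_mono_ae hpt
  have hm : Measurable (μ.rnDeriv ν) := Measure.measurable_rnDeriv μ ν
  rw [lintegral_add_right _ measurable_const, lintegral_add_right _ (by fun_prop),
    lintegral_add_right _ (by fun_prop),
    lintegral_rnDeriv_mul hac (by fun_prop), lintegral_rnDeriv_mul hac (by fun_prop),
    ← klDiv_eq_lintegral_klFun_of_ac hac] at hint
  simp only [lintegral_const, measure_univ, mul_one] at hint
  exact ENNReal.le_of_add_le_add_right ENNReal.one_ne_top (hint.trans (by gcongr))

lemma PMF.lintegral_toMeasure {Ω : Type*} [MeasurableSpace Ω] [Countable Ω]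
    [MeasurableSingletonClass Ω] (p : PMF Ω) (f : Ω → ℝ≥0∞) :
    ∫⁻ ω, f ω ∂p.toMeasure = ∑' ω, p ω * f ω := by
  rw [lintegral_countable']
  exact tsum_congr fun ω => by
    rw [PMF.toMeasure_apply_singleton _ _ (measurableSet_singleton ω), mul_comm]

/-- A lower bound for the mutual information through a test function `A - B`. -/
lemma tsum_le_mutualInformation_add {α β : Type} [Countable α] [Countable β] (J : PMF (α × β))
    {A B : α × β → ℝ} (hA0 : ∀ z, 0 ≤ A z) (hB0 : ∀ z, 0 ≤ B z)
    (hexp : ∀ b, ∑' a, (J.map Prod.fst) a * ENNReal.ofReal (Real.exp (A (a, b) - B (a, b))) ≤ 1) :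
    ∑' z, J z * ENNReal.ofReal (A z)
      ≤ mutualInformation J + ∑' z, J z * ENNReal.ofReal (B z) := by
  let _ : MeasurableSpace α := ⊤
  let _ : MeasurableSpace β := ⊤
  have h := lintegral_le_klDiv_add_lintegral J.toMeasure
    ((J.map Prod.fst).toMeasure.prod (J.map Prod.snd).toMeasure) (A := A) (B := B)
    (measurable_of_countable _) (measurable_of_countable _) hA0 hB0 (by
      rw [lintegral_prod_symm _ (measurable_of_countable _).aemeasurable]
      refine (lintegral_mono fun b => ?_).trans_eq (lintegral_one.trans measure_univ)
      rw [PMF.lintegral_toMeasure]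
      exact hexp b)
  rw [PMF.lintegral_toMeasure, PMF.lintegral_toMeasure] at h
  refine h.trans ?_
  gcongr
  have hlog : ENNReal.ofReal (Real.log 2) ≤ 1 := by
    rw [ENNReal.ofReal_le_one]
    exact Real.log_two_lt_d9.le.trans (by norm_num)
  exact (ENNReal.le_div_iff_mul_le (by simp [Real.log_pos]) (by simp)).2
    (mul_le_of_le_one_right' hlog)

end Divergence

/-! ### Sums over boards and the rectangle property -/

section BoardSum

/-- The sum of `G` over all boards that consist of `t` messages, as an iterated sum over the
messages. -/
noncomputable def boardSum : ℕ → (Board → ℝ≥0∞) → ℝ≥0∞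
  | 0, G => G []
  | t + 1, G => boardSum t fun h => ∑' m, G (h ++ [m])

lemma boardSum_mono {t : ℕ} {F G : Board → ℝ≥0∞} (h : ∀ π : Board, π.length = t → F π ≤ G π) :
    boardSum t F ≤ boardSum t G := by
  induction t generalizing F G with
  | zero => exact h [] rfl
  | succ t ih => exact ih fun π hπ => ENNReal.tsum_le_tsum fun m => h _ (by simp [hπ])

lemma boardSum_congr {t : ℕ} {F G : Board → ℝ≥0∞}
    (h : ∀ π : Board, π.length = t → F π = G π) : boardSum t F = boardSum t G :=
  le_antisymm (boardSum_mono fun π hπ => (h π hπ).le) (boardSum_mono fun π hπ => (h π hπ).ge)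

lemma boardSum_add (t : ℕ) (F G : Board → ℝ≥0∞) :
    boardSum t (fun π => F π + G π) = boardSum t F + boardSum t G := by
  induction t generalizing F G with
  | zero => rfl
  | succ t ih => simp only [boardSum, ENNReal.tsum_add, ih]

lemma boardSum_const_mul (t : ℕ) (c : ℝ≥0∞) (F : Board → ℝ≥0∞) :
    boardSum t (fun π => c * F π) = c * boardSum t F := by
  induction t generalizing F with
  | zero => rfl
  | succ t ih => simp only [boardSum, ENNReal.tsum_mul_left, ih]

lemma boardSum_sum {ι : Type*} (t : ℕ) (s : Finset ι) (F : ι → Board → ℝ≥0∞) :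
    boardSum t (fun π => ∑ i ∈ s, F i π) = ∑ i ∈ s, boardSum t (F i) := by
  induction t generalizing F with
  | zero => rfl
  | succ t ih =>
    simp only [boardSum]
    rw [← ih]
    congr 1
    ext h
    exact Summable.tsum_finsetSum fun _ _ => ENNReal.summable

lemma unifAvg_boardSum {Ω : Type*} [Fintype Ω] (t : ℕ) (F : Ω → Board → ℝ≥0∞) :
    unifAvg (fun x => boardSum t (F x)) = boardSum t fun π => unifAvg fun x => F x π := by
  simp only [unifAvg, boardSum_const_mul, boardSum_sum]

end BoardSum

lemma PMF.tsum_bind_mul {α β : Type*} (p : PMF α) (f : α → PMF β) (G : β → ℝ≥0∞) :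
    ∑' b, p.bind f b * G b = ∑' a, p a * ∑' b, f a b * G b := by
  simp only [PMF.bind_apply, ← ENNReal.tsum_mul_right, ← ENNReal.tsum_mul_left]
  rw [ENNReal.tsum_comm]
  simp only [mul_assoc]

lemma PMF.tsum_pure_mul {α : Type*} (a : α) (G : α → ℝ≥0∞) :
    ∑' b, PMF.pure a b * G b = G a := by
  rw [tsum_eq_single a]
  · simp
  · intro b hb
    simp [PMF.pure_apply, hb]

lemma PMF.tsum_map_mul {α β : Type*} (p : PMF α) (f : α → β) (G : β → ℝ≥0∞) :
    ∑' b, p.map f b * G b = ∑' a, p a * G (f a) := by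
  simp only [PMF.map, PMF.tsum_bind_mul, Function.comp_apply, PMF.tsum_pure_mul]

namespace PrivateCoinProtocol

variable {k : ℕ} [NeZero k] {X Y : Type}

/-- The probability that player `i` with input `y` sends the messages that stand on the board `π` at
the turns of player `i`, given the messages of the other players. -/
noncomputable def likelihood (P : PrivateCoinProtocol k X Y) (i : Fin k) (y : X) (π : Board) :
    ℝ≥0∞ :=
  ∏ s ∈ Finset.range π.length,
    if speaker k s = i then P.message i y (π.take s) (π.getD s []) else 1

@[simp]
lemma likelihood_nil (P : PrivateCoinProtocol k X Y) (i : Fin k) (y : X) :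
    P.likelihood i y [] = 1 := by
  simp [likelihood]

lemma likelihood_concat (P : PrivateCoinProtocol k X Y) (i : Fin k) (y : X) (h : Board)
    (m : Message) :
    P.likelihood i y (h ++ [m])
      = P.likelihood i y h * if speaker k h.length = i then P.message i y h m else 1 := by
  simp only [likelihood, List.length_append, List.length_singleton, Finset.prod_range_succ]
  congr 1
  · refine Finset.prod_congr rfl fun s hs => ?_
    have hs' : s < h.length := Finset.mem_range.1 hs
    rw [List.take_append_of_le_length hs'.le, List.getD_append _ _ _ _ hs']
  · simp

lemma likelihood_le_one (P : PrivateCoinProtocol k X Y) (i : Fin k) (y : X) (π : Board) :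
    P.likelihood i y π ≤ 1 := by
  refine Finset.prod_le_one' fun s _ => ?_
  split_ifs
  · exact PMF.coe_le_one _ _
  · exact le_rfl

/-- The joint likelihood of the board `π` for the players in `S`. -/
noncomputable def jointLikelihood (P : PrivateCoinProtocol k X Y) (S : Finset (Fin k))
    (x : Fin k → X) (π : Board) : ℝ≥0∞ :=
  ∏ i ∈ S, P.likelihood i (x i) π

@[simp]
lemma jointLikelihood_nil (P : PrivateCoinProtocol k X Y) (S : Finset (Fin k)) (x : Fin k → X) :
    P.jointLikelihood S x [] = 1 := by
  simp [jointLikelihood]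

lemma jointLikelihood_concat (P : PrivateCoinProtocol k X Y) (S : Finset (Fin k)) (x : Fin k → X)
    (h : Board) (m : Message) :
    P.jointLikelihood S x (h ++ [m]) = P.jointLikelihood S x h *
      if speaker k h.length ∈ S then
        P.message (speaker k h.length) (x (speaker k h.length)) h m else 1 := by
  simp only [jointLikelihood, likelihood_concat, Finset.prod_mul_distrib, Finset.prod_ite_eq]

lemma jointLikelihood_le_one (P : PrivateCoinProtocol k X Y) (S : Finset (Fin k)) (x : Fin k → X)
    (π : Board) : P.jointLikelihood S x π ≤ 1 :=
  Finset.prod_le_one' fun _ _ => P.likelihood_le_one _ _ _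

lemma dependsOn_jointLikelihood (P : PrivateCoinProtocol k X Y) (S : Finset (Fin k)) (π : Board) :
    DependsOn (fun x => P.jointLikelihood S x π) (S : Set (Fin k)) := by
  intro x y h
  exact Finset.prod_congr rfl fun i hi => by rw [h i hi]

lemma jointLikelihood_mul (P : PrivateCoinProtocol k X Y) {S T : Finset (Fin k)} (h : IsCompl S T) (x : Fin k → X) (π : Board) :
    P.jointLikelihood S x π * P.jointLikelihood T x π = P.jointLikelihood Finset.univ x π := by
  rw [jointLikelihood, jointLikelihood, jointLikelihood, ← Finset.prod_union h.disjoint]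
  congr 1
  exact h.codisjoint.eq_top

lemma dependsOn_ite_jointLikelihood (P : PrivateCoinProtocol k X Y) {β : Type} [DecidableEq β]
    {S : Finset (Fin k)} {V : (Fin k → X) → β}
    (hV : DependsOn V (S : Set (Fin k))) (v : β) (π : Board) :
    DependsOn (fun x => if V x = v then P.jointLikelihood S x π else 0) (S : Set (Fin k)) := by
  intro x y h
  simp only [hV h, P.dependsOn_jointLikelihood S π h]

lemma tsum_jointLikelihood_concat (P : PrivateCoinProtocol k X Y) {S : Finset (Fin k)}
    (x : Fin k → X) {h : Board} (hS : speaker k h.length ∈ S) :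
    ∑' m, P.jointLikelihood S x (h ++ [m]) = P.jointLikelihood S x h := by
  simp only [jointLikelihood_concat, hS, if_true, ENNReal.tsum_mul_left, PMF.tsum_coe, mul_one]

/-- The rectangle property: the probability of a board is the product of the likelihoods of the
players. -/
lemma tsum_boardDist_mul (P : PrivateCoinProtocol k X Y) (x : Fin k → X) (t : ℕ)
    (G : Board → ℝ≥0∞) :
    ∑' π, P.boardDist x t π * G π
      = boardSum t fun π => P.jointLikelihood Finset.univ x π * G π := by
  induction t generalizing G with
  | zero => simp [boardDist, boardSum]
  | succ t ih =>
    simp only [boardDist, PMF.tsum_bind_mul, PMF.tsum_map_mul, boardSum]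
    rw [ih]
    refine boardSum_congr fun h hh => ?_
    simp only [jointLikelihood_concat, hh, Finset.mem_univ, if_true, mul_assoc,
      ENNReal.tsum_mul_left]

lemma boardSum_jointLikelihood (P : PrivateCoinProtocol k X Y) (x : Fin k → X) (t : ℕ) :
    boardSum t (P.jointLikelihood Finset.univ x) = 1 := by
  have h := P.tsum_boardDist_mul x t fun _ => 1
  simpa [PMF.tsum_coe] using h.symm

end PrivateCoinProtocol

/-! ### Distance from uniform given the board -/

namespace PrivateCoinProtocol

variable {k : ℕ} [NeZero k] {X Y : Type} [Fintype X]

section Marginals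

/-- The probability, over uniform inputs, of the part of the board `π` that the players in `S`
contribute. -/
noncomputable def boardProb (P : PrivateCoinProtocol k X Y) (S : Finset (Fin k)) (π : Board) :
    ℝ≥0∞ :=
  unifAvg fun x => P.jointLikelihood S x π

/-- The joint probability, over uniform inputs, of the event `V = v` and of the part of the board
`π` that the players in `S` contribute. -/
noncomputable def pointProb {β : Type} [DecidableEq β] (P : PrivateCoinProtocol k X Y)
    (S : Finset (Fin k)) (V : (Fin k → X) → β) (v : β) (π : Board) : ℝ≥0∞ :=
  unifAvg fun x => if V x = v then P.jointLikelihood S x π else 0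

variable {β γ : Type} [DecidableEq β] [DecidableEq γ]
variable (P : PrivateCoinProtocol k X Y)

lemma boardProb_le_one [Nonempty X] (S : Finset (Fin k)) (π : Board) : P.boardProb S π ≤ 1 :=
  unifAvg_le_one fun _ => P.jointLikelihood_le_one _ _ _

lemma boardProb_ne_top [Nonempty X] (S : Finset (Fin k)) (π : Board) : P.boardProb S π ≠ ⊤ :=
  ((P.boardProb_le_one S π).trans_lt ENNReal.one_lt_top).ne

lemma sum_pointProb [Fintype β] (S : Finset (Fin k)) (V : (Fin k → X) → β) (π : Board) :
    ∑ v, P.pointProb S V v π = P.boardProb S π := by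
  simp only [pointProb, ← unifAvg_sum, Finset.sum_ite_eq, Finset.mem_univ, if_true, boardProb]

lemma pointProb_le_boardProb (S : Finset (Fin k)) (V : (Fin k → X) → β) (v : β) (π : Board) :
    P.pointProb S V v π ≤ P.boardProb S π :=
  unifAvg_mono fun x => by split_ifs <;> simp

/-- Given the board, the inputs of disjoint groups of players are independent. -/
lemma unifAvg_ite_and_mul_jointLikelihood [Nonempty X] {S T : Finset (Fin k)} (h : IsCompl S T)
    {V : (Fin k → X) → β} {Z : (Fin k → X) → γ} (hV : DependsOn V (S : Set (Fin k)))
    (hZ : DependsOn Z (T : Set (Fin k))) (v : β) (z : γ) (π : Board) :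
    unifAvg (fun x => if V x = v ∧ Z x = z then P.jointLikelihood Finset.univ x π else 0)
      = P.pointProb S V v π * P.pointProb T Z z π := by
  rw [pointProb, pointProb, ← unifAvg_mul_of_dependsOn (P.dependsOn_ite_jointLikelihood hV v π)
    (dependsOn_compl_of_isCompl h (P.dependsOn_ite_jointLikelihood hZ z π))]
  congr 1
  ext x
  by_cases h1 : V x = v <;> by_cases h2 : Z x = z <;> simp [h1, h2, P.jointLikelihood_mul h]

lemma boardProb_mul [Nonempty X] {S T : Finset (Fin k)} (h : IsCompl S T) (π : Board) :
    P.boardProb S π * P.boardProb T π = P.boardProb Finset.univ π := by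
  simp only [boardProb, ← P.jointLikelihood_mul h]
  exact (unifAvg_mul_of_dependsOn (P.dependsOn_jointLikelihood S π)
    (dependsOn_compl_of_isCompl h (P.dependsOn_jointLikelihood T π))).symm

lemma pointProb_mul_boardProb [Nonempty X] {S T : Finset (Fin k)} (h : IsCompl S T) {V : (Fin k → X) → β}
    (hV : DependsOn V (S : Set (Fin k))) (v : β) (π : Board) :
    P.pointProb S V v π * P.boardProb T π = P.pointProb Finset.univ V v π := by
  rw [pointProb, boardProb, ← unifAvg_mul_of_dependsOn (P.dependsOn_ite_jointLikelihood hV v π)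
    (dependsOn_compl_of_isCompl h (P.dependsOn_jointLikelihood T π)), pointProb]
  congr 1
  ext x
  split_ifs
  · exact P.jointLikelihood_mul h x π
  · simp

lemma boardSum_boardProb [Nonempty X] (t : ℕ) : boardSum t (P.boardProb Finset.univ) = 1 := by
  have h : boardSum t (P.boardProb Finset.univ)
      = unifAvg fun x => boardSum t (P.jointLikelihood Finset.univ x) := by
    rw [unifAvg_boardSum]
    rfl
  rw [h]
  simp only [boardSum_jointLikelihood, unifAvg_const]

lemma tsum_boardProb_concat {S : Finset (Fin k)} {h : Board} (hS : speaker k h.length ∈ S) :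
    ∑' m, P.boardProb S (h ++ [m]) = P.boardProb S h := by
  simp only [boardProb, ← unifAvg_tsum, P.tsum_jointLikelihood_concat _ hS]

lemma tsum_pointProb_concat {S : Finset (Fin k)} (V : (Fin k → X) → β) (v : β) {h : Board}
    (hS : speaker k h.length ∈ S) :
    ∑' m, P.pointProb S V v (h ++ [m]) = P.pointProb S V v h := by
  simp only [pointProb, ← unifAvg_tsum]
  congr 1
  ext x
  split_ifs
  · exact P.tsum_jointLikelihood_concat _ hS
  · simp

lemma boardProb_concat_of_notMem {S : Finset (Fin k)} {h : Board} (hS : speaker k h.length ∉ S)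
    (m : Message) : P.boardProb S (h ++ [m]) = P.boardProb S h := by
  simp [boardProb, jointLikelihood_concat, hS]

lemma pointProb_concat_of_notMem {S : Finset (Fin k)} (V : (Fin k → X) → β) (v : β) {h : Board}
    (hS : speaker k h.length ∉ S) (m : Message) :
    P.pointProb S V v (h ++ [m]) = P.pointProb S V v h := by
  simp [pointProb, jointLikelihood_concat, hS]

end Marginals

section Deficit

variable {n : ℕ} (P : PrivateCoinProtocol k X Y)

/-- The expected total variation distance between the conditional law of `V` given the first `t`
messages and the uniform law on `[n]`. It is written as the mass missing from the conditional
law; the subtraction is the truncated one of `[0, ∞]`. -/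
noncomputable def deficit (V : (Fin k → X) → Fin n) (t : ℕ) : ℝ≥0∞ :=
  boardSum t fun π => ∑ v, (P.boardProb Finset.univ π / n - P.pointProb Finset.univ V v π)

/-- More messages can only move the conditional law of `V` away from uniform, by convexity of the
total variation distance. -/
lemma deficit_mono (V : (Fin k → X) → Fin n) : Monotone (P.deficit V) := by
  refine monotone_nat_of_le_succ fun t => ?_
  simp only [deficit, boardSum]
  refine boardSum_mono fun h hh => ?_
  rw [Summable.tsum_finsetSum fun _ _ => ENNReal.summable]
  refine Finset.sum_le_sum fun v _ => ?_
  rw [tsub_le_iff_right, ← P.tsum_pointProb_concat V v (Finset.mem_univ _),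
    ← P.tsum_boardProb_concat (Finset.mem_univ (speaker k h.length)), ← ENNReal.tsum_add,
    div_eq_mul_inv, ← ENNReal.tsum_mul_right]
  exact ENNReal.tsum_le_tsum fun m => le_tsub_add

end Deficit

section Chasing

variable {n : ℕ} (P : PrivateCoinProtocol k (Fin n → Fin n) Y)

/-- The expected distance from uniform of the law of the value of the function of player `i` given
the board, at the random point `z`, which is also drawn given the board. -/
noncomputable def chaseDeficit (i : Fin k) (z : (Fin k → Fin n → Fin n) → Fin n) (t : ℕ) : ℝ≥0∞ :=
  boardSum t fun π => ∑ a, P.pointProb {i}ᶜ z a π *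
    ∑ v, (P.boardProb {i} π / n - P.pointProb {i} (fun x => x i a) v π)

/-- Jensen's inequality over the random point at which the function of player `i` is evaluated. -/
lemma deficit_le_chaseDeficit [NeZero n] (i : Fin k) {z : (Fin k → Fin n → Fin n) → Fin n}
    (hz : DependsOn z ((({i} : Finset (Fin k))ᶜ : Finset (Fin k)) : Set (Fin k))) (t : ℕ) :
    P.deficit (fun x => x i (z x)) t ≤ P.chaseDeficit i z t := by
  refine boardSum_mono fun π _ => ?_
  have hc : IsCompl ({i} : Finset (Fin k)) {i}ᶜ := isCompl_compl
  have hpt : ∀ v, P.pointProb Finset.univ (fun x => x i (z x)) v π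
      = ∑ a, P.pointProb {i}ᶜ z a π * P.pointProb {i} (fun x => x i a) v π := by
    intro v
    simp only [mul_comm (P.pointProb {i}ᶜ z _ π),
      ← P.unifAvg_ite_and_mul_jointLikelihood hc (dependsOn_apply i _) hz]
    rw [← unifAvg_sum, pointProb]
    congr 1
    ext x
    rw [Finset.sum_eq_single (z x)]
    · simp
    · intro a _ ha
      simp [ha.symm]
    · simp
  have hw : P.boardProb Finset.univ π / n
      = ∑ a, P.pointProb {i}ᶜ z a π * (P.boardProb {i} π / n) := by
    rw [← Finset.sum_mul, P.sum_pointProb, ← P.boardProb_mul hc, mul_comm (P.boardProb {i} π),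
      mul_div_assoc]
  calc ∑ v, (P.boardProb Finset.univ π / n
        - P.pointProb Finset.univ (fun x => x i (z x)) v π)
      ≤ ∑ v, ∑ a, P.pointProb {i}ᶜ z a π *
          (P.boardProb {i} π / n - P.pointProb {i} (fun x => x i a) v π) := by
        refine Finset.sum_le_sum fun v _ => ?_
        rw [hw, hpt, tsub_le_iff_right, ← Finset.sum_add_distrib]
        refine Finset.sum_le_sum fun a _ => ?_
        rw [← mul_add]
        gcongr
        exact le_tsub_add
    _ = _ := by
        rw [Finset.sum_comm]
        simp only [Finset.mul_sum]

/-- Messages of other players do not change the conditional law of the function of player `i`. -/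
lemma chaseDeficit_succ {i : Fin k} (z : (Fin k → Fin n → Fin n) → Fin n) {t : ℕ}
    (ht : speaker k t ≠ i) : P.chaseDeficit i z (t + 1) = P.chaseDeficit i z t := by
  simp only [chaseDeficit, boardSum]
  refine boardSum_congr fun h hh => ?_
  have h1 : speaker k h.length ∉ ({i} : Finset (Fin k)) := by simpa [hh] using ht
  have h2 : speaker k h.length ∈ ({i}ᶜ : Finset (Fin k)) := by simpa [hh] using ht
  rw [Summable.tsum_finsetSum fun _ _ => ENNReal.summable]
  simp only [P.boardProb_concat_of_notMem h1, P.pointProb_concat_of_notMem _ _ h1,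
    ENNReal.tsum_mul_right, P.tsum_pointProb_concat z _ h2]

lemma chaseDeficit_eq_of_forall_speaker_ne {i : Fin k} (z : (Fin k → Fin n → Fin n) → Fin n)
    {s t : ℕ} (hst : s ≤ t) (h : ∀ u, s ≤ u → u < t → speaker k u ≠ i) :
    P.chaseDeficit i z t = P.chaseDeficit i z s := by
  induction t, hst using Nat.le_induction with
  | base => rfl
  | succ t hst ih =>
    rw [P.chaseDeficit_succ z (h t hst (Nat.lt_succ_self t)),
      ih fun u hu hut => h u hu (hut.trans (Nat.lt_succ_self t))]

lemma chaseDeficit_zero [NeZero n] (i : Fin k) (z : (Fin k → Fin n → Fin n) → Fin n) :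
    P.chaseDeficit i z 0 = 0 := by
  have h : ∀ a v, P.pointProb {i} (fun x => x i a) v [] = 1 / n := by
    intro a v
    simp only [pointProb, jointLikelihood_nil]
    rw [unifAvg_apply i fun y : Fin n → Fin n => if y a = v then (1 : ℝ≥0∞) else 0,
      unifAvg_apply a fun u : Fin n => if u = v then (1 : ℝ≥0∞) else 0, unifAvg_ite_eq_one_div]
  simp [chaseDeficit, boardSum, h, boardProb, unifAvg_const]

/-- If the point `z` is close to uniform given the board, and the values of the function of player
`i` are so on average, then the value at `z` is close to uniform, too. -/
lemma chaseDeficit_le [NeZero n] (i : Fin k) {z : (Fin k → Fin n → Fin n) → Fin n}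
    (hz : DependsOn z ((({i} : Finset (Fin k))ᶜ : Finset (Fin k)) : Set (Fin k))) (t : ℕ) :
    P.chaseDeficit i z t
      ≤ P.deficit z t + (n : ℝ≥0∞)⁻¹ * ∑ a, P.deficit (fun x => x i a) t := by
  have hc : IsCompl ({i} : Finset (Fin k)) {i}ᶜ := isCompl_compl
  simp only [deficit]
  rw [← boardSum_sum, ← boardSum_const_mul, ← boardSum_add]
  refine boardSum_mono fun π _ => ?_
  set q := P.boardProb {i} π
  set b := fun a => P.pointProb {i}ᶜ z a π with hb
  set e := fun a => ∑ v, (q / n - P.pointProb {i} (fun x => x i a) v π) with he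
  have hq : q ≠ ⊤ := P.boardProb_ne_top _ _
  have hB : ∑ a, b a = P.boardProb {i}ᶜ π := P.sum_pointProb _ _ _
  have hBt : ∑ a, b a ≠ ⊤ := hB ▸ P.boardProb_ne_top _ _
  have heq : ∀ a, e a ≤ q := fun a =>
    (Finset.sum_le_sum fun v _ => tsub_le_self).trans_eq (sum_const_div q)
  have h1 : ∑ a, b a * e a
      ≤ ∑ a, ((∑ c, b c) / n) * e a + ∑ a, (b a - (∑ c, b c) / n) * q := by
    rw [← Finset.sum_add_distrib]
    refine Finset.sum_le_sum fun a _ => ?_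
    calc b a * e a ≤ ((∑ c, b c) / n + (b a - (∑ c, b c) / n)) * e a := by
          gcongr
          exact le_add_tsub
      _ = (∑ c, b c) / n * e a + (b a - (∑ c, b c) / n) * e a := add_mul _ _ _
      _ ≤ _ := by gcongr; exact heq a
  refine h1.trans ?_
  rw [add_comm]
  refine add_le_add (le_of_eq ?_) (le_of_eq ?_)
  · rw [← Finset.sum_mul, sum_tsub_div_eq hBt, Finset.sum_mul]
    refine Finset.sum_congr rfl fun a _ => ?_
    rw [ENNReal.sub_mul fun _ _ => hq, hB, ← P.pointProb_mul_boardProb hc.symm hz,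
      ← P.boardProb_mul hc, mul_comm q, ENNReal.mul_div_right_comm]
  · rw [Finset.mul_sum]
    refine Finset.sum_congr rfl fun a _ => ?_
    rw [hB, div_eq_mul_inv, mul_comm _ (n : ℝ≥0∞)⁻¹, mul_assoc, he, Finset.mul_sum]
    congr 1
    refine Finset.sum_congr rfl fun v _ => ?_
    rw [ENNReal.mul_sub fun _ _ => P.boardProb_ne_top _ _,
      ← P.pointProb_mul_boardProb hc (dependsOn_apply i a), ← P.boardProb_mul hc,
      mul_comm _ (P.pointProb _ _ _ _), mul_comm q, mul_div_assoc]

end Chasing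

end PrivateCoinProtocol

/-! ### Information cost and the distance from uniform -/

section SubsetTest

lemma Real.exp_le_one_add_add_sq {x : ℝ} (hx : |x| ≤ 1) : Real.exp x ≤ 1 + x + x ^ 2 := by
  have h := (abs_le.1 (Real.abs_exp_sub_one_sub_id_le hx)).2
  linarith

/-- A bound for the exponential moment of the centred indicator function of a subset of `[n]`. -/
lemma unifAvg_exp_indicator_le_one {n : ℕ} [NeZero n] (L : Finset (Fin n)) {s : ℝ} (hs : 0 ≤ s)
    (hs1 : s ≤ 1) :
    unifAvg (fun v : Fin n => ENNReal.ofReal (Real.exp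
      (s * ((L.card : ℝ) / n - if v ∈ L then 1 else 0) - s ^ 2))) ≤ 1 := by
  have hn : (0 : ℝ) < n := Nat.cast_pos.2 (NeZero.pos n)
  have hL : (L.card : ℝ) / n ≤ 1 := by
    rw [div_le_one hn]
    exact_mod_cast (Finset.card_le_univ L).trans_eq (Fintype.card_fin n)
  have hL0 : 0 ≤ (L.card : ℝ) / n := by positivity
  set m := (L.card : ℝ) / n with hm
  have hpt : ∀ v : Fin n, Real.exp (s * (m - if v ∈ L then 1 else 0) - s ^ 2)
      ≤ Real.exp (-s ^ 2) * (1 + s ^ 2 + s * (m - if v ∈ L then 1 else 0)) := by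
    intro v
    rw [sub_eq_add_neg, add_comm, ← neg_sq s, neg_sq, Real.exp_add]
    gcongr
    set y : ℝ := m - if v ∈ L then 1 else 0 with hy
    have hy1 : |y| ≤ 1 := by
      rw [hy, abs_le]
      split_ifs <;> constructor <;> linarith
    have hsy : |s * y| ≤ 1 := by
      rw [abs_mul, abs_of_nonneg hs]
      exact mul_le_one₀ hs1 (abs_nonneg y) hy1
    have hsq : (s * y) ^ 2 ≤ s ^ 2 := by
      rw [mul_pow]
      exact mul_le_of_le_one_right (sq_nonneg s) ((sq_le_one_iff_abs_le_one y).2 hy1)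
    linarith [Real.exp_le_one_add_add_sq hsy]
  have hsum : ∑ v : Fin n, Real.exp (s * (m - if v ∈ L then 1 else 0) - s ^ 2) ≤ n := by
    refine (Finset.sum_le_sum fun v _ => hpt v).trans ?_
    rw [← Finset.mul_sum, Finset.sum_add_distrib, ← Finset.mul_sum, Finset.sum_sub_distrib]
    have h0 : (n : ℝ) * m - L.card = 0 := by rw [hm]; field_simp; ring
    simp only [Finset.sum_const, Finset.card_univ, Fintype.card_fin, nsmul_eq_mul,
      Finset.sum_ite_mem, Finset.univ_inter, mul_one, h0, mul_zero, add_zero]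
    rw [Real.exp_neg, inv_mul_le_iff₀ (Real.exp_pos _), mul_comm]
    gcongr
    linarith [Real.add_one_le_exp (s ^ 2)]
  rw [unifAvg, ← ENNReal.ofReal_sum_of_nonneg fun _ _ => Real.exp_nonneg _, Fintype.card_fin]
  calc (n : ℝ≥0∞)⁻¹ * ENNReal.ofReal _ ≤ (n : ℝ≥0∞)⁻¹ * ENNReal.ofReal (n : ℝ) := by gcongr
    _ = 1 := by
      rw [ENNReal.ofReal_natCast]
      exact ENNReal.inv_mul_cancel (by simp [NeZero.ne n]) (by simp)

end SubsetTest

namespace PrivateCoinProtocol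

variable {k : ℕ} [NeZero k] {X Y : Type}

/-- Expectations with respect to a uniform input and the resulting transcript. -/
lemma tsum_input_transcript_mul [Fintype X] [Nonempty X] (P : PrivateCoinProtocol k X Y) (r : ℕ)
    (G : (Fin k → X) × Board → ℝ≥0∞) :
    ∑' z, ((PMF.uniformOfFintype (Fin k → X)).bind fun x =>
        (P.transcriptDist r x).map fun h => (x, h)) z * G z
      = boardSum (k * r - 1) fun π =>
          unifAvg fun x => P.jointLikelihood Finset.univ x π * G (x, π) := by
  simp only [PMF.tsum_bind_mul, PMF.tsum_map_mul, transcriptDist, tsum_boardDist_mul]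
  rw [unifAvg_eq_tsum_uniformOfFintype, unifAvg_boardSum]

lemma map_fst_input_transcript (P : PrivateCoinProtocol k X Y) (r : ℕ) (ψ : PMF (Fin k → X)) :
    (ψ.bind fun x => (P.transcriptDist r x).map fun h => (x, h)).map Prod.fst = ψ := by
  rw [PMF.map_bind]
  simp only [PMF.map_comp, Function.comp_def]
  have : ∀ x, (P.transcriptDist r x).map (fun _ => x) = PMF.pure x := fun x => PMF.map_const _ _
  simp only [this, PMF.bind_pure]

section Information

variable {n : ℕ} (P : PrivateCoinProtocol k (Fin n → Fin n) Y)

/-- The values `v` that the value of the function of player `i` at `a` takes with probability less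
than `1 / n`, given the board `π`. -/
noncomputable def deficientValues (i : Fin k) (a : Fin n) (π : Board) : Finset (Fin n) :=
  {v | P.pointProb Finset.univ (fun x => x i a) v π < P.boardProb Finset.univ π / n}

lemma sum_tsub_add_sum_deficientValues (i : Fin k) (a : Fin n) (π : Board) :
    ∑ v, (P.boardProb Finset.univ π / n - P.pointProb Finset.univ (fun x => x i a) v π)
        + ∑ v ∈ P.deficientValues i a π, P.pointProb Finset.univ (fun x => x i a) v π
      = (P.deficientValues i a π).card / n * P.boardProb Finset.univ π := by
  have h : ∑ v, (P.boardProb Finset.univ π / n - P.pointProb Finset.univ (fun x => x i a) v π)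
      = ∑ v ∈ P.deficientValues i a π,
        (P.boardProb Finset.univ π / n - P.pointProb Finset.univ (fun x => x i a) v π) := by
    refine (Finset.sum_subset (Finset.subset_univ _) fun v _ hv => ?_).symm
    exact tsub_eq_zero_of_le (by simpa [deficientValues] using hv)
  rw [h, ← Finset.sum_add_distrib]
  have h2 : ∀ v ∈ P.deficientValues i a π,
      (P.boardProb Finset.univ π / n - P.pointProb Finset.univ (fun x => x i a) v π)
        + P.pointProb Finset.univ (fun x => x i a) v π = P.boardProb Finset.univ π / n := by
    intro v hv
    exact tsub_add_cancel_of_le (by simpa [deficientValues] using hv : _ < _).le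
  rw [Finset.sum_congr rfl h2, Finset.sum_const, nsmul_eq_mul]
  simp only [div_eq_mul_inv]
  ring

/-- A protocol of small information cost leaves the values of the function of player `i` close to
uniform on average. The test function in the variational bound for the mutual information counts,
with weight `s`, the points at which the function takes a deficient value. -/
lemma mul_sum_deficit_le_informationCost_add [NeZero n] (i : Fin k) (r : ℕ) {s : ℝ} (hs : 0 ≤ s)
    (hs1 : s ≤ 1) :
    ENNReal.ofReal s * ∑ a, P.deficit (fun x => x i a) (k * r - 1)
      ≤ P.informationCost r (PMF.uniformOfFintype (Fin k → Fin n → Fin n))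
        + ENNReal.ofReal (s ^ 2 * n) := by
  classical
  set t := k * r - 1 with ht
  set S := ENNReal.ofReal s with hS
  let A : (Fin k → Fin n → Fin n) × Board → ℝ := fun z =>
    s * ∑ a, ((P.deficientValues i a z.2).card : ℝ) / n
  let B : (Fin k → Fin n → Fin n) × Board → ℝ := fun z =>
    s * ∑ a, (if z.1 i a ∈ P.deficientValues i a z.2 then (1 : ℝ) else 0) + s ^ 2 * n
  have hA0 : ∀ z, 0 ≤ A z := fun z =>
    mul_nonneg hs (Finset.sum_nonneg fun a _ => div_nonneg (Nat.cast_nonneg _) (Nat.cast_nonneg _))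
  have hB0 : ∀ z, 0 ≤ B z := fun z =>
    add_nonneg (mul_nonneg hs (Finset.sum_nonneg fun a _ => by split_ifs <;> norm_num))
      (mul_nonneg (sq_nonneg s) (Nat.cast_nonneg n))
  have hexp : ∀ π, unifAvg (fun x =>
      ENNReal.ofReal (Real.exp (A (x, π) - B (x, π)))) ≤ 1 := by
    intro π
    have hprod : ∀ x : Fin k → Fin n → Fin n, ENNReal.ofReal (Real.exp (A (x, π) - B (x, π)))
        = ∏ a, ENNReal.ofReal (Real.exp (s * (((P.deficientValues i a π).card : ℝ) / n
            - if x i a ∈ P.deficientValues i a π then 1 else 0) - s ^ 2)) := by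
      intro x
      rw [← ENNReal.ofReal_prod_of_nonneg fun _ _ => Real.exp_nonneg _, ← Real.exp_sum]
      congr 2
      simp only [A, B, Finset.sum_sub_distrib, ← Finset.mul_sum, Finset.sum_const,
        Finset.card_univ, Fintype.card_fin, nsmul_eq_mul]
      ring
    simp only [hprod]
    rw [unifAvg_apply i fun y : Fin n → Fin n =>
      ∏ a, ENNReal.ofReal (Real.exp (s * (((P.deficientValues i a π).card : ℝ) / n
            - if y a ∈ P.deficientValues i a π then 1 else 0) - s ^ 2)),
      unifAvg_pi_prod fun a v =>
        ENNReal.ofReal (Real.exp (s * (((P.deficientValues i a π).card : ℝ) / n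
            - if v ∈ P.deficientValues i a π then 1 else 0) - s ^ 2))]
    exact Finset.prod_le_one' fun a _ => unifAvg_exp_indicator_le_one _ hs hs1
  have hAB := tsum_le_mutualInformation_add
    ((PMF.uniformOfFintype (Fin k → Fin n → Fin n)).bind fun x =>
        (P.transcriptDist r x).map fun h => (x, h)) hA0 hB0 (fun π => by
    rw [map_fst_input_transcript, unifAvg_eq_tsum_uniformOfFintype]
    exact hexp π)
  rw [tsum_input_transcript_mul, tsum_input_transcript_mul] at hAB
  have hAe : ∀ z, ENNReal.ofReal (A z)
      = S * ∑ a, ((P.deficientValues i a z.2).card : ℝ≥0∞) / n := by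
    intro z
    rw [ENNReal.ofReal_mul hs, ENNReal.ofReal_sum_of_nonneg fun _ _ => by positivity]
    congr 1
    refine Finset.sum_congr rfl fun a _ => ?_
    rw [ENNReal.ofReal_div_of_pos (Nat.cast_pos.2 (NeZero.pos n)), ENNReal.ofReal_natCast,
      ENNReal.ofReal_natCast]
  have hBe : ∀ z, ENNReal.ofReal (B z)
      = S * ∑ a, (if z.1 i a ∈ P.deficientValues i a z.2 then (1 : ℝ≥0∞) else 0)
        + ENNReal.ofReal (s ^ 2 * n) := by
    intro z
    have h0 : ∀ a, 0 ≤ if z.1 i a ∈ P.deficientValues i a z.2 then (1 : ℝ) else 0 := fun a => by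
      split_ifs <;> norm_num
    rw [ENNReal.ofReal_add (mul_nonneg hs (Finset.sum_nonneg fun a _ => h0 a)) (by positivity),
      ENNReal.ofReal_mul hs, ENNReal.ofReal_sum_of_nonneg fun a _ => h0 a]
    congr 2
    refine Finset.sum_congr rfl fun a _ => ?_
    split_ifs <;> simp
  -- the expected number of deficient values that are hit, times `s`
  set H := boardSum t fun π => S * ∑ a, ∑ v ∈ P.deficientValues i a π,
    P.pointProb Finset.univ (fun x => x i a) v π with hH
  have hEA : boardSum t (fun π => unifAvg fun x =>
      P.jointLikelihood Finset.univ x π * ENNReal.ofReal (A (x, π)))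
      = S * ∑ a, P.deficit (fun x => x i a) t + H := by
    simp only [deficit]
    rw [hH, ← boardSum_sum, ← boardSum_const_mul, ← boardSum_add]
    refine boardSum_congr fun π _ => ?_
    simp only [hAe, unifAvg_mul_const]
    rw [← mul_add, ← Finset.sum_add_distrib]
    simp only [P.sum_tsub_add_sum_deficientValues]
    rw [← Finset.sum_mul, boardProb]
    ring
  have hEB : boardSum t (fun π => unifAvg fun x =>
      P.jointLikelihood Finset.univ x π * ENNReal.ofReal (B (x, π)))
      = H + ENNReal.ofReal (s ^ 2 * n) := by
    have hc : ENNReal.ofReal (s ^ 2 * n)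
        = boardSum t fun π => ENNReal.ofReal (s ^ 2 * n) * P.boardProb Finset.univ π := by
      rw [boardSum_const_mul, boardSum_boardProb, mul_one]
    rw [hc, hH, ← boardSum_add]
    refine boardSum_congr fun π _ => ?_
    simp only [hBe, mul_add, unifAvg_add, unifAvg_mul_const]
    rw [mul_comm (ENNReal.ofReal (s ^ 2 * n)), boardProb]
    congr 1
    simp only [mul_left_comm _ S, unifAvg_const_mul]
    congr 1
    simp only [Finset.mul_sum, unifAvg_sum]
    refine Finset.sum_congr rfl fun a _ => ?_
    simp only [pointProb, ← unifAvg_sum]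
    congr 1
    ext x
    simp
  have hHt : H ≠ ⊤ := by
    have : H ≤ boardSum t fun π => (S * n) * P.boardProb Finset.univ π := by
      refine boardSum_mono fun π _ => ?_
      rw [mul_assoc]
      gcongr
      calc ∑ a, ∑ v ∈ P.deficientValues i a π, P.pointProb Finset.univ (fun x => x i a) v π
          ≤ ∑ a : Fin n, P.boardProb Finset.univ π :=
            Finset.sum_le_sum fun a _ => (Finset.sum_le_sum_of_subset (Finset.subset_univ _)).trans
              (P.sum_pointProb _ _ _).le
        _ = n * P.boardProb Finset.univ π := by simp
    rw [boardSum_const_mul, boardSum_boardProb, mul_one] at this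
    exact (this.trans_lt (ENNReal.mul_lt_top ENNReal.ofReal_lt_top (by simp))).ne
  rw [hEA, hEB] at hAB
  refine ENNReal.le_of_add_le_add_right hHt (hAB.trans_eq ?_)
  rw [informationCost]
  ring

end Information

end PrivateCoinProtocol

/-! ### Pointer chasing and round elimination -/

lemma mul_le_mul_add_tsub_mul_add_mul_tsub (a b u w : ℝ≥0∞) :
    a * b ≤ u * w + (a - u) * b + a * (b - w) := by
  rcases le_total a u with h | h
  · calc a * b ≤ a * (w + (b - w)) := by gcongr; exact le_add_tsub
      _ = a * w + a * (b - w) := mul_add _ _ _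
      _ ≤ u * w + a * (b - w) := by gcongr
      _ ≤ _ := by gcongr; exact le_self_add
  · calc a * b ≤ (u + (a - u)) * b := by gcongr; exact le_add_tsub
      _ = u * b + (a - u) * b := add_mul _ _ _
      _ ≤ u * (w + (b - w)) + (a - u) * b := by gcongr; exact le_add_tsub
      _ = u * w + (a - u) * b + u * (b - w) := by ring
      _ ≤ _ := by gcongr

section Pointer

variable {k n : ℕ} [NeZero n]

/-- The pointer reached from the element `1` of `[n]` after `j` steps, where step `l` (counted from
`0`) applies the function of player `e l`. -/
def chasedPointer (e : ℕ → Fin k) : ℕ → (Fin k → Fin n → Fin n) → Fin n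
  | 0, _ => 0
  | j + 1, x => x (e j) (chasedPointer e j x)

lemma chasedPointer_congr {e : ℕ → Fin k} {j : ℕ} {x y : Fin k → Fin n → Fin n}
    (h : ∀ l < j, x (e l) = y (e l)) : chasedPointer e j x = chasedPointer e j y := by
  induction j with
  | zero => rfl
  | succ j ih =>
    rw [chasedPointer, chasedPointer, ih fun l hl => h l (hl.trans (Nat.lt_succ_self j)),
      h j (Nat.lt_succ_self j)]

lemma pointerChasing_eq_chasedPointer {p : ℕ} (f : Fin p → Fin n → Fin n) {e : ℕ → Fin k}
    {x : Fin k → Fin n → Fin n} (h : ∀ j (hj : j < p), x (e j) = f ⟨p - 1 - j, by omega⟩) :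
    pointerChasing f = chasedPointer e p x := by
  induction p with
  | zero => simp [pointerChasing, chasedPointer]
  | succ p ih =>
    have h1 : pointerChasing f = f 0 (pointerChasing fun i => f i.succ) := by
      simp [pointerChasing, List.ofFn_succ]
    have h2 : x (e p) = f 0 := by
      rw [h p (Nat.lt_succ_self p)]
      congr 1
      ext
      simp
    rw [h1, chasedPointer, h2, ih fun i => f i.succ]
    intro j hj
    rw [h j (hj.trans (Nat.lt_succ_self p))]
    congr 1
    ext
    simp only [Fin.val_succ]
    omega

end Pointer

namespace PrivateCoinProtocol

variable {k : ℕ} [NeZero k] {X Y : Type}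

/-- The induction of the round elimination: at the time `τ j` the pointer after `j + 1` steps is
close to uniform given the board, provided that player `e 0` is silent before time `τ 0` and player
`e (j + 1)` is silent between the times `τ j` and `τ (j + 1)`. Each step costs the average
distance from uniform of the values of one function. -/
lemma deficit_chasedPointer_le {n p : ℕ} [NeZero n]
    (P : PrivateCoinProtocol k (Fin n → Fin n) Y) {e : ℕ → Fin k}
    (he : ∀ l j, l < j → j < p → e l ≠ e j) {τ : ℕ → ℕ} (hτ : Monotone τ)
    (h0 : ∀ u < τ 0, speaker k u ≠ e 0)
    (hstep : ∀ j, j + 1 < p → ∀ u, τ j ≤ u → u < τ (j + 1) → speaker k u ≠ e (j + 1))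
    {D : ℝ≥0∞} (hD : ∀ i j, (n : ℝ≥0∞)⁻¹ * ∑ a, P.deficit (fun x => x i a) (τ j) ≤ D)
    {j : ℕ} (hj : j < p) : P.deficit (chasedPointer e (j + 1)) (τ j) ≤ j * D := by
  have hdep : ∀ j < p, DependsOn (chasedPointer (n := n) e j)
      ((({e j} : Finset (Fin k))ᶜ : Finset (Fin k)) : Set (Fin k)) := by
    intro j hj x y hxy
    exact chasedPointer_congr fun l hl => hxy _ (by simpa using he l j hl hj)
  induction j with
  | zero =>
    refine (P.deficit_le_chaseDeficit (e 0) (hdep 0 hj) (τ 0)).trans ?_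
    rw [P.chaseDeficit_eq_of_forall_speaker_ne _ (Nat.zero_le _) fun u _ hu => h0 u hu,
      chaseDeficit_zero]
    exact zero_le
  | succ j ih =>
    refine (P.deficit_le_chaseDeficit (e (j + 1)) (hdep (j + 1) hj) (τ (j + 1))).trans ?_
    rw [P.chaseDeficit_eq_of_forall_speaker_ne _ (hτ (Nat.le_succ j)) (hstep j hj)]
    refine (P.chaseDeficit_le (e (j + 1)) (hdep (j + 1) hj) (τ j)).trans ?_
    rw [Nat.cast_succ, add_mul, one_mul]
    exact add_le_add (ih (by omega)) (hD _ _)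

/-- The probability that the last player outputs `b` on input `x` after `t` messages. -/
noncomputable def answerProb (P : PrivateCoinProtocol k X Bool) (t : ℕ) (x : Fin k → X) (b : Bool) :
    ℝ≥0∞ :=
  boardSum t fun π => P.jointLikelihood Finset.univ x π * P.output (x (lastPlayer k)) π b

lemma answerProb_false_add_true (P : PrivateCoinProtocol k X Bool) (t : ℕ) (x : Fin k → X) :
    P.answerProb t x false + P.answerProb t x true = 1 := by
  rw [answerProb, answerProb, ← boardSum_add, ← P.boardSum_jointLikelihood x t]
  refine boardSum_congr fun π _ => ?_
  have h := (P.output (x (lastPlayer k)) π).tsum_coe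
  rw [tsum_fintype, Fintype.sum_bool, add_comm] at h
  rw [← mul_add, h, mul_one]

lemma errorProb_eq_answerProb (P : PrivateCoinProtocol k X Bool) (r : ℕ) (f : (Fin k → X) → Bool)
    (x : Fin k → X) : P.errorProb r f x = P.answerProb (k * r - 1) x (!f x) := by
  have h : {y | y ≠ f x} = {!f x} := by
    ext y
    cases y <;> cases f x <;> simp
  rw [errorProb, h, PMF.toOuterMeasure_apply_singleton, outputDist, PMF.bind_apply,
    transcriptDist, tsum_boardDist_mul, answerProb]

/-! ### The equality test -/

section Equality

variable [Fintype X] [Nonempty X] {n : ℕ} [NeZero n]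

/-- If `F` is close to uniform given the board, and `G` is independent of `F` given the board, then
`F = G` has probability about `1 / n` at most. -/
lemma unifAvg_eq_le (P : PrivateCoinProtocol k X Y) {S T : Finset (Fin k)} (hST : IsCompl S T)
    {F G : (Fin k → X) → Fin n} (hF : DependsOn F (S : Set (Fin k)))
    (hG : DependsOn G (T : Set (Fin k))) (t : ℕ) :
    unifAvg (fun x => if F x = G x then (1 : ℝ≥0∞) else 0) ≤ 1 / n + P.deficit F t := by
  have h1 : unifAvg (fun x => if F x = G x then (1 : ℝ≥0∞) else 0)
      = boardSum t fun π => ∑ v, P.pointProb S F v π * P.pointProb T G v π := by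
    have h : ∀ x, (if F x = G x then (1 : ℝ≥0∞) else 0)
        = boardSum t fun π => if F x = G x then P.jointLikelihood Finset.univ x π else 0 := by
      intro x
      split_ifs
      · exact (P.boardSum_jointLikelihood x t).symm
      · simpa using (boardSum_const_mul t 0 fun _ => 0).symm
    simp only [h, unifAvg_boardSum]
    refine boardSum_congr fun π _ => ?_
    simp only [← P.unifAvg_ite_and_mul_jointLikelihood hST hF hG, ← unifAvg_sum]
    congr 1
    ext x
    rw [Finset.sum_eq_single (F x)]
    · simp [eq_comm]
    · intro v _ hv
      simp [hv.symm]
    · simp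
  have h2 : (1 / n : ℝ≥0∞) = boardSum t fun π => 1 / n * P.boardProb Finset.univ π := by
    rw [boardSum_const_mul, boardSum_boardProb, mul_one]
  rw [h1, h2, deficit, ← boardSum_add]
  refine boardSum_mono fun π _ => ?_
  set u := fun v => P.pointProb S F v π with hu
  have hU : ∑ v, u v = P.boardProb S π := P.sum_pointProb _ _ _
  have hUt : ∑ v, u v ≠ ⊤ := hU ▸ P.boardProb_ne_top _ _
  set w := P.boardProb T π with hw
  calc ∑ v, u v * P.pointProb T G v π
      ≤ ∑ v, ((∑ c, u c) / n * P.pointProb T G v π + (u v - (∑ c, u c) / n) * w) := by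
        refine Finset.sum_le_sum fun v _ => ?_
        calc u v * P.pointProb T G v π
            ≤ ((∑ c, u c) / n + (u v - (∑ c, u c) / n)) * P.pointProb T G v π := by
              gcongr
              exact le_add_tsub
          _ ≤ _ := by
              rw [add_mul]
              gcongr
              exact P.pointProb_le_boardProb _ _ _ _
    _ = 1 / n * P.boardProb Finset.univ π
        + ∑ v, (P.boardProb Finset.univ π / n - P.pointProb Finset.univ F v π) := by
        rw [Finset.sum_add_distrib, ← Finset.mul_sum, P.sum_pointProb T G, ← Finset.sum_mul,
          sum_tsub_div_eq hUt, Finset.sum_mul, hU, ← P.boardProb_mul hST]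
        congr 1
        · simp only [div_eq_mul_inv]
          ring
        · refine Finset.sum_congr rfl fun v _ => ?_
          rw [ENNReal.sub_mul fun _ _ => P.boardProb_ne_top _ _, ← hw,
            ← P.pointProb_mul_boardProb hST hF, ENNReal.mul_div_right_comm]

/-- If `F` and `G` are close to uniform and independent given the board, and the answer `1` is
unlikely, then the answer `0` is given in spite of `F = G` with probability of order `1 / n`. -/
lemma one_div_le_unifAvg_eq_answerProb (P : PrivateCoinProtocol k X Bool) {S T : Finset (Fin k)}
    (hST : IsCompl S T) (hlast : lastPlayer k ∈ T) {F G : (Fin k → X) → Fin n}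
    (hF : DependsOn F (S : Set (Fin k))) (hG : DependsOn G (T : Set (Fin k))) (t : ℕ) :
    (1 / n : ℝ≥0∞) ≤ unifAvg (fun x => if F x = G x then P.answerProb t x false else 0)
      + 1 / n * (P.deficit F t + P.deficit G t + unifAvg fun x => P.answerProb t x true) := by
  -- `w b v π` is the probability that `G = v`, that the players in `T` contribute their part of
  -- `π`, and that the output is `b`
  set w : Bool → Fin n → Board → ℝ≥0∞ := fun b v π => unifAvg fun x =>
    if G x = v then P.jointLikelihood T x π * P.output (x (lastPlayer k)) π b else 0 with hw
  have hwdep : ∀ b v π, DependsOn (fun x => if G x = v then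
      P.jointLikelihood T x π * P.output (x (lastPlayer k)) π b else 0) (T : Set (Fin k)) := by
    intro b v π x y hxy
    simp only [hG hxy, P.dependsOn_jointLikelihood T π hxy, hxy _ hlast]
  have hwsum : ∀ v π, P.pointProb T G v π = w false v π + w true v π := by
    intro v π
    rw [hw, ← unifAvg_add, pointProb]
    congr 1
    ext x
    have h := (P.output (x (lastPlayer k)) π).tsum_coe
    rw [tsum_fintype, Fintype.sum_bool, add_comm] at h
    split_ifs
    · rw [← mul_add, h, mul_one]
    · simp
  have hE : unifAvg (fun x => if F x = G x then P.answerProb t x false else 0)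
      = boardSum t fun π => ∑ v, P.pointProb S F v π * w false v π := by
    have h : ∀ x, (if F x = G x then P.answerProb t x false else 0)
        = boardSum t fun π => if F x = G x then
          P.jointLikelihood Finset.univ x π * P.output (x (lastPlayer k)) π false else 0 := by
      intro x
      split_ifs
      · rfl
      · simpa using (boardSum_const_mul t 0 fun _ => 0).symm
    simp only [h, unifAvg_boardSum]
    refine boardSum_congr fun π _ => ?_
    simp only [hw, pointProb, ← unifAvg_mul_of_dependsOn (P.dependsOn_ite_jointLikelihood hF _ π)
      (dependsOn_compl_of_isCompl hST (hwdep _ _ π)), ← unifAvg_sum]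
    congr 1
    ext x
    rw [Finset.sum_eq_single (F x)]
    · by_cases hx : F x = G x
      · simp [hx, ← P.jointLikelihood_mul hST, mul_assoc]
      · simp [hx, Ne.symm hx]
    · intro v _ hv
      simp [hv.symm]
    · simp
  have hα : unifAvg (fun x => P.answerProb t x true)
      = boardSum t fun π => ∑ v, P.boardProb S π * w true v π := by
    simp only [answerProb, unifAvg_boardSum]
    refine boardSum_congr fun π _ => ?_
    simp only [hw, boardProb, ← unifAvg_mul_of_dependsOn (P.dependsOn_jointLikelihood S π)
      (dependsOn_compl_of_isCompl hST (hwdep _ _ π)), ← unifAvg_sum]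
    congr 1
    ext x
    simp [← P.jointLikelihood_mul hST, mul_assoc]
  have h1 : (1 / n : ℝ≥0∞) = boardSum t fun π => 1 / n * P.boardProb Finset.univ π := by
    rw [boardSum_const_mul, boardSum_boardProb, mul_one]
  conv_lhs => rw [h1]
  rw [hE, hα, deficit, deficit, ← boardSum_add, ← boardSum_add, ← boardSum_const_mul,
    ← boardSum_add]
  refine boardSum_mono fun π _ => ?_
  set b := P.boardProb S π with hb
  set c := P.boardProb T π with hc
  have hbt : b ≠ ⊤ := P.boardProb_ne_top _ _
  have hct : c ≠ ⊤ := P.boardProb_ne_top _ _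
  have hpt : ∀ v, b / n * (c / n) ≤ P.pointProb S F v π * w false v π
      + 1 / n * ((P.boardProb Finset.univ π / n - P.pointProb Finset.univ F v π)
        + (P.boardProb Finset.univ π / n - P.pointProb Finset.univ G v π) + b * w true v π) := by
    intro v
    refine (mul_le_mul_add_tsub_mul_add_mul_tsub _ _ (P.pointProb S F v π) (w false v π)).trans ?_
    have hF' : P.boardProb Finset.univ π / n - P.pointProb Finset.univ F v π
        = (b / n - P.pointProb S F v π) * c := by
      rw [ENNReal.sub_mul fun _ _ => hct, hc, P.pointProb_mul_boardProb hST hF,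
        ← P.boardProb_mul hST, ENNReal.mul_div_right_comm]
    have hG' : P.boardProb Finset.univ π / n - P.pointProb Finset.univ G v π
        = b * (c / n - P.pointProb T G v π) := by
      rw [ENNReal.mul_sub fun _ _ => hbt, mul_comm b (P.pointProb T G v π), hb,
        P.pointProb_mul_boardProb hST.symm hG, ← P.boardProb_mul hST, mul_div_assoc]
    have hsub : c / n - w false v π ≤ (c / n - P.pointProb T G v π) + w true v π := by
      rw [tsub_le_iff_right, add_assoc, add_comm (w true v π), ← hwsum]
      exact le_tsub_add
    rw [hF', hG', add_assoc]
    gcongr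
    calc (b / n - P.pointProb S F v π) * (c / n) + b / n * (c / n - w false v π)
        ≤ (b / n - P.pointProb S F v π) * (c / n)
          + b / n * ((c / n - P.pointProb T G v π) + w true v π) := by gcongr
      _ = _ := by simp only [div_eq_mul_inv]; ring
  calc 1 / n * P.boardProb Finset.univ π = ∑ v : Fin n, b / n * (c / n) := by
        rw [← Finset.mul_sum, sum_const_div, ← P.boardProb_mul hST]
        simp only [div_eq_mul_inv]
        ring
    _ ≤ _ := Finset.sum_le_sum fun v _ => hpt v
    _ = _ := by simp only [Finset.sum_add_distrib, ← Finset.mul_sum]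

end Equality

end PrivateCoinProtocol

/-! ### Limited pointer chasing equality -/

section LimitedPointerChasing

namespace PrivateCoinProtocol

variable {n p : ℕ} [NeZero n] [NeZero p]

/-- The player whose function is applied in step `j` (counted from `0`) of a chase through the `p`
consecutive players `o - p, …, o - 1`, from the last one to the first one. The two halves of the
input are the cases `o = p` and `o = 2 p`. -/
def chasePlayer (p : ℕ) [NeZero p] {o : ℕ} (ho : o ≤ 2 * p) (j : ℕ) : Fin (2 * p) :=
  ⟨o - 1 - j, by have := NeZero.pos p; omega⟩

/-- Within `p - 1` rounds, in which the players speak in the order opposite to that of the chase, the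
last pointer of each half remains close to uniform. -/
lemma deficit_chasedPointer_chasePlayer_le {Y : Type}
    (P : PrivateCoinProtocol (2 * p) (Fin n → Fin n) Y) {o : ℕ} (hpo : p ≤ o) (ho : o ≤ 2 * p)
    {D : ℝ≥0∞} (hD : ∀ i, (n : ℝ≥0∞)⁻¹ * ∑ a, P.deficit (fun x => x i a) (2 * p * (p - 1) - 1) ≤ D) :
    P.deficit (chasedPointer (chasePlayer p ho) p) (2 * p * (p - 1) - 1) ≤ p * D := by
  have hp : 0 < p := NeZero.pos p
  set T := 2 * p * (p - 1) - 1 with hT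
  -- the time just before the player of step `j` speaks for the `(j + 1)`-st time
  set τ : ℕ → ℕ := fun j => min (2 * p * j + (o - 1 - j)) T with hτ
  have hmono : Monotone τ := by
    refine monotone_nat_of_le_succ fun j => ?_
    have : 2 * p * (j + 1) = 2 * p * j + 2 * p := by ring
    simp only [hτ]
    exact min_le_min_right _ (by omega)
  have hlast : τ (p - 1) = T := by
    simp only [hτ]
    exact min_eq_right (by omega)
  have h := P.deficit_chasedPointer_le (p := p) (e := chasePlayer p ho) (τ := τ) (D := D) ?_ hmono
    ?_ ?_ ?_ (j := p - 1) (by omega)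
  · rw [hlast, Nat.sub_add_cancel hp] at h
    refine h.trans ?_
    gcongr
    omega
  · intro l j hlj hj heq
    have := congrArg Fin.val heq
    simp only [chasePlayer] at this
    omega
  · intro u hu heq
    have h1 := congrArg Fin.val heq
    have h2 : u < o - 1 := by
      have := lt_of_lt_of_le hu (min_le_left _ _)
      omega
    simp only [speaker, chasePlayer, Nat.mod_eq_of_lt (show u < 2 * p by omega)] at h1
    omega
  · intro j hj u hu1 hu2 heq
    have h1 : u % (2 * p) = o - 1 - (j + 1) := congrArg Fin.val heq
    have hdiv := Nat.div_add_mod u (2 * p)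
    have hu3 := lt_of_lt_of_le hu2 (min_le_left _ _)
    have hu4 := lt_of_lt_of_le hu2 (min_le_right _ _)
    have hu5 : 2 * p * j + (o - 1 - j) ≤ u := by
      simp only [hτ] at hu1
      rcases min_le_iff.1 hu1 with h | h
      · exact h
      · omega
    rw [h1] at hdiv
    -- the number of complete rounds before time `u` lies strictly between `j` and `j + 1`
    have h2 : 2 * p * j < 2 * p * (u / (2 * p)) := by omega
    have h3 : 2 * p * (u / (2 * p)) < 2 * p * (j + 1) := by omega
    have h4 := lt_of_mul_lt_mul_left h2 (Nat.zero_le _)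
    have h5 := lt_of_mul_lt_mul_left h3 (Nat.zero_le _)
    omega
  · intro i j
    refine le_trans ?_ (hD i)
    gcongr with a
    exact P.deficit_mono _ (min_le_right _ _)

lemma pointerChasing_firstHalf (x : Fin (2 * p) → Fin n → Fin n) :
    pointerChasing (firstHalf x)
      = chasedPointer (chasePlayer p (o := p) (by omega)) p x := by
  refine pointerChasing_eq_chasedPointer _ fun j hj => ?_
  rfl

lemma pointerChasing_secondHalf (x : Fin (2 * p) → Fin n → Fin n) :
    pointerChasing (secondHalf x)
      = chasedPointer (chasePlayer p (o := 2 * p) le_rfl) p x := by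
  refine pointerChasing_eq_chasedPointer _ fun j hj => ?_
  simp only [secondHalf, chasePlayer]
  congr 2
  omega

/-- If the information cost is at most `n / (64 p ^ 2)`, then the values of the function of each
player are on average at distance at most `1 / (4 p)` from uniform. -/
lemma inv_mul_sum_deficit_le {Y : Type} (P : PrivateCoinProtocol (2 * p) (Fin n → Fin n) Y) (r : ℕ)
    (hI : P.informationCost r (PMF.uniformOfFintype (Fin (2 * p) → Fin n → Fin n))
      ≤ ENNReal.ofReal (n / (64 * (p : ℝ) ^ 2))) (i : Fin (2 * p)) :
    (n : ℝ≥0∞)⁻¹ * ∑ a, P.deficit (fun x => x i a) (2 * p * r - 1)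
      ≤ ENNReal.ofReal (1 / (4 * p)) := by
  have hp : (1 : ℝ) ≤ p := by exact_mod_cast NeZero.one_le
  have hn : (0 : ℝ) < n := Nat.cast_pos.2 (NeZero.pos n)
  -- this weight balances the two terms of the bound
  have h := (P.mul_sum_deficit_le_informationCost_add i r (s := 1 / (8 * p)) (by positivity)
    (by rw [div_le_one (by positivity)]; linarith)).trans (add_le_add_left hI _)
  rw [← ENNReal.ofReal_add (by positivity) (by positivity)] at h
  set σ := ∑ a, P.deficit (fun x => x i a) (2 * p * r - 1)
  calc (n : ℝ≥0∞)⁻¹ * σ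
      = ENNReal.ofReal (8 * p / n) * (ENNReal.ofReal (1 / (8 * p)) * σ) := by
        rw [← mul_assoc, ← ENNReal.ofReal_mul (by positivity), ← ENNReal.ofReal_natCast,
          ← ENNReal.ofReal_inv_of_pos hn]
        congr 2
        field_simp
    _ ≤ ENNReal.ofReal (8 * p / n)
          * ENNReal.ofReal (n / (64 * (p : ℝ) ^ 2) + (1 / (8 * p)) ^ 2 * n) := by gcongr
    _ = ENNReal.ofReal (1 / (4 * p)) := by
        rw [← ENNReal.ofReal_mul (by positivity)]
        congr 1
        field_simp
        norm_num

open Classical in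
lemma unifAvg_isNonInjective_le {C : ℝ} (hC : IsNonInjectivityConstant C) :
    unifAvg (fun f : Fin n → Fin n =>
        if IsNonInjective (C * (1 + Real.logb 2 n)) f then (1 : ℝ≥0∞) else 0)
      ≤ ENNReal.ofReal (1 / (2 * (n : ℝ) ^ 2)) := by
  have h := ENNReal.ofReal_le_ofReal (hC n (NeZero.pos n))
  refine le_trans (le_of_eq ?_) h
  rw [ENNReal.ofReal_div_of_pos (Nat.cast_pos.2 Nat.card_pos), ENNReal.ofReal_natCast,
    ENNReal.ofReal_natCast, unifAvg, Finset.sum_boole, ← Fintype.card_subtype,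
    Nat.card_eq_fintype_card, Nat.card_eq_fintype_card, mul_comm, div_eq_mul_inv]

open Classical in
/-- A protocol that errs with probability at most `1 / (64 n)` has a large information cost.
Otherwise the two last pointers are close to uniform and independent given the board. Equality is then
rare, so that the answer `1` is rare, and hence the answer `0` is given in a constant fraction of the
cases of equality, which have probability about `1 / n`. -/
lemma lt_informationCost_of_avgErrorProb_le {C : ℝ} (hC : IsNonInjectivityConstant C)
    (hn : 18 * p ^ 2 ≤ n) (P : PrivateCoinProtocol (2 * p) (Fin n → Fin n) Bool)
    (hP : P.avgErrorProb (p - 1) (lpce n p (C * (1 + Real.logb 2 n)))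
      (PMF.uniformOfFintype (Fin (2 * p) → Fin n → Fin n)) ≤ 1 / (64 * (n : ℝ≥0∞))) :
    ENNReal.ofReal (n / (64 * (p : ℝ) ^ 2))
      < P.informationCost (p - 1) (PMF.uniformOfFintype (Fin (2 * p) → Fin n → Fin n)) := by
  by_contra! hI
  have hp0 : 0 < p := NeZero.pos p
  have hD := P.inv_mul_sum_deficit_le (p - 1) hI
  set T := 2 * p * (p - 1) - 1 with hT
  set r := C * (1 + Real.logb 2 n) with hr
  set F := chasedPointer (n := n) (chasePlayer p (o := p) (by omega)) p with hF
  set G := chasedPointer (n := n) (chasePlayer p (o := 2 * p) le_rfl) p with hG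
  have hη : (p : ℝ≥0∞) * ENNReal.ofReal (1 / (4 * p)) = ENNReal.ofReal (1 / 4) := by
    rw [← ENNReal.ofReal_natCast, ← ENNReal.ofReal_mul (by positivity)]
    congr 1
    have : (p : ℝ) ≠ 0 := by positivity
    field_simp
  have hdF : P.deficit F T ≤ ENNReal.ofReal (1 / 4) :=
    hη ▸ P.deficit_chasedPointer_chasePlayer_le le_rfl _ hD
  have hdG : P.deficit G T ≤ ENNReal.ofReal (1 / 4) :=
    hη ▸ P.deficit_chasedPointer_chasePlayer_le (by omega) _ hD
  let S : Finset (Fin (2 * p)) := {i | i.1 < p}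
  have hST : IsCompl S Sᶜ := isCompl_compl
  have hFS : DependsOn F (S : Set (Fin (2 * p))) := fun x y hxy =>
    chasedPointer_congr fun l hl => hxy _ (by
      simp only [S, chasePlayer, Finset.coe_filter, Finset.mem_univ, true_and, Set.mem_ofPred_eq]
      omega)
  have hGS : DependsOn G ((Sᶜ : Finset (Fin (2 * p))) : Set (Fin (2 * p))) := fun x y hxy =>
    chasedPointer_congr fun l hl => hxy _ (by
      simp only [S, chasePlayer, Finset.coe_compl, Finset.coe_filter, Finset.mem_univ, true_and,
        Set.mem_compl_iff, Set.mem_ofPred_eq]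
      omega)
  have hlast : lastPlayer (2 * p) ∈ Sᶜ := by
    simp only [S, lastPlayer, Finset.mem_compl, Finset.mem_filter, Finset.mem_univ, true_and]
    omega
  have hans : ∀ x, lpce n p r x = true ↔ (∃ j, IsNonInjective r (x j)) ∨ F x = G x := by
    intro x
    rw [lpce, decide_eq_true_iff, pointerChasing_firstHalf, pointerChasing_secondHalf]
  have herr : unifAvg (fun x => P.answerProb T x (!lpce n p r x)) ≤ 1 / (64 * (n : ℝ≥0∞)) := by
    refine le_trans (le_of_eq ?_) hP
    simp only [avgErrorProb, errorProb_eq_answerProb]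
    rw [unifAvg_eq_tsum_uniformOfFintype]
  have h1 := P.one_div_le_unifAvg_eq_answerProb hST hlast hFS hGS T
  have h2 := P.unifAvg_eq_le hST hFS hGS T
  have h3 : unifAvg (fun x => if F x = G x then P.answerProb T x false else 0)
      ≤ 1 / (64 * (n : ℝ≥0∞)) := by
    refine (unifAvg_mono fun x => ?_).trans herr
    split_ifs with hx
    · rw [(hans x).2 (Or.inr hx)]
      exact le_rfl
    · exact zero_le
  have hle1 : ∀ x, P.answerProb T x true ≤ 1 := fun x =>
    le_of_le_of_eq le_add_self (P.answerProb_false_add_true T x)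
  have h4 : unifAvg (fun x => P.answerProb T x true) ≤ 1 / (64 * (n : ℝ≥0∞))
      + (1 / n + ENNReal.ofReal (1 / 4)) + (2 * p : ℕ) * ENNReal.ofReal (1 / (2 * (n : ℝ) ^ 2)) := by
    have hpt : ∀ x, P.answerProb T x true ≤ P.answerProb T x (!lpce n p r x)
        + (if F x = G x then 1 else 0) + ∑ j, (if IsNonInjective r (x j) then 1 else 0) := by
      intro x
      by_cases hx : lpce n p r x = true
      · rcases (hans x).1 hx with ⟨j, hj⟩ | hx
        · refine (hle1 x).trans (le_trans ?_ le_add_self)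
          refine le_trans (by simp [hj]) (Finset.single_le_sum
            (f := fun j => if IsNonInjective r (x j) then (1 : ℝ≥0∞) else 0)
            (fun _ _ => zero_le) (Finset.mem_univ j))
        · refine (hle1 x).trans (le_trans ?_ le_self_add)
          simp [hx]
      · simp only [Bool.not_eq_true] at hx
        rw [hx]
        exact le_add_right le_self_add
    refine (unifAvg_mono hpt).trans ?_
    rw [unifAvg_add, unifAvg_add, unifAvg_sum]
    refine add_le_add (add_le_add herr (h2.trans (by gcongr))) ?_
    refine (Finset.sum_le_sum fun j _ => (unifAvg_apply j fun f : Fin n → Fin n =>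
      if IsNonInjective r f then (1 : ℝ≥0∞) else 0).trans_le
        (unifAvg_isNonInjective_le hC)).trans_eq ?_
    simp
  have h5 : (1 / n : ℝ≥0∞) ≤ 1 / (64 * (n : ℝ≥0∞)) + 1 / n * (ENNReal.ofReal (1 / 4)
      + ENNReal.ofReal (1 / 4) + (1 / (64 * (n : ℝ≥0∞)) + (1 / n + ENNReal.ofReal (1 / 4))
        + (2 * p : ℕ) * ENNReal.ofReal (1 / (2 * (n : ℝ) ^ 2)))) :=
    h1.trans (by gcongr)
  have hnr : (0 : ℝ) < n := Nat.cast_pos.2 (NeZero.pos n)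
  have e1 : (1 / n : ℝ≥0∞) = ENNReal.ofReal (1 / n) := by
    rw [ENNReal.ofReal_div_of_pos hnr, ENNReal.ofReal_one, ENNReal.ofReal_natCast]
  have e2 : 1 / (64 * (n : ℝ≥0∞)) = ENNReal.ofReal (1 / (64 * n)) := by
    rw [ENNReal.ofReal_div_of_pos (by positivity), ENNReal.ofReal_one,
      ENNReal.ofReal_mul (by norm_num), ENNReal.ofReal_natCast]
    norm_num
  rw [e2, e1, ← ENNReal.ofReal_natCast, ← ENNReal.ofReal_mul (by positivity),
    ← ENNReal.ofReal_add (by positivity) (by positivity),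
    ← ENNReal.ofReal_add (by positivity) (by positivity),
    ← ENNReal.ofReal_add (by positivity) (by positivity),
    ← ENNReal.ofReal_add (by positivity) (by positivity),
    ← ENNReal.ofReal_add (by positivity) (by positivity),
    ← ENNReal.ofReal_mul (by positivity),
    ← ENNReal.ofReal_add (by positivity) (by positivity),
    ENNReal.ofReal_le_ofReal_iff (by positivity)] at h5
  have hn' : 18 * (p : ℝ) ^ 2 ≤ n := by exact_mod_cast hn
  have hp : (1 : ℝ) ≤ p := by exact_mod_cast hp0
  have hpn : 18 * (p : ℝ) ≤ n := by nlinarith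
  have hn18 : (18 : ℝ) ≤ n := by linarith
  set y : ℝ := 1 / n with hy
  have hy0 : 0 < y := by positivity
  have hny : (n : ℝ) * y = 1 := by rw [hy]; field_simp
  have hy18 : y ≤ 1 / 18 := by
    rw [hy]
    gcongr
  have hpy : (p : ℝ) * y ≤ 1 / 18 := by nlinarith
  have e3 : 1 / (64 * (n : ℝ)) = y / 64 := by rw [hy]; field_simp
  have e4 : ((2 * p : ℕ) : ℝ) * (1 / (2 * (n : ℝ) ^ 2)) = (p * y) * y := by
    rw [hy]; push_cast; field_simp
  rw [e3, e4] at h5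
  have h6 : 1 ≤ 1 / 64 + (1 / 4 + 1 / 4 + (y / 64 + (y + 1 / 4) + p * y * y)) := by
    refine le_of_mul_le_mul_left ?_ hy0
    linarith
  nlinarith

end PrivateCoinProtocol

lemma distInformationComplexity_le_informationComplexity {k : ℕ} [NeZero k] {X Y : Type} (r : ℕ)
    (F : (Fin k → X) → Y) (ψ : PMF (Fin k → X)) (δ : ℝ≥0∞) :
    distInformationComplexity r F ψ δ ≤ informationComplexity r F ψ δ := by
  refine le_iInf₂ fun P hP => iInf₂_le P ?_
  calc P.avgErrorProb r F ψ ≤ ∑' x, ψ x * δ := ENNReal.tsum_le_tsum fun x => by gcongr; exact hP x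
    _ = δ := by rw [ENNReal.tsum_mul_right, PMF.tsum_coe, one_mul]

end LimitedPointerChasing

theorem mainTheorem3 :
    (∀ C : ℝ, IsNonInjectivityConstant C →
      ∀ (n p : ℕ) [NeZero n] [NeZero p], 18 * p ^ 2 ≤ n →
        ((n / (2 ^ 29 * 3 ^ 5 * (p : ℝ) ^ 16)
            - (⌈2 * Real.logb 2 n⌉ : ℝ) / (2 ^ 13 * 3 ^ 2 * (p : ℝ) ^ 8) - 2 : ℝ) : EReal)
          ≤ (informationComplexity (p - 1) (lpce n p (C * (1 + Real.logb 2 n)))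
              (PMF.uniformOfFintype (Fin (2 * p) → Fin n → Fin n))
              (1 / (64 * (n : ℝ≥0∞))) : EReal) ∧
        ((n / (2 ^ 29 * 3 ^ 5 * (p : ℝ) ^ 16)
            - (⌈2 * Real.logb 2 n⌉ : ℝ) / (2 ^ 13 * 3 ^ 2 * (p : ℝ) ^ 8) - 2 : ℝ) : EReal)
          ≤ (distInformationComplexity (p - 1) (lpce n p (C * (1 + Real.logb 2 n)))
              (PMF.uniformOfFintype (Fin (2 * p) → Fin n → Fin n))
              (1 / (64 * (n : ℝ≥0∞))) : EReal)) ∧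
    ∃ c > (0 : ℝ), ∃ K > (0 : ℝ), ∀ n p : ℕ, 0 < n → 0 < p → 18 * p ^ 2 ≤ n →
      c * (n / (p : ℝ) ^ 16) - K * (Real.logb 2 n / (p : ℝ) ^ 8 + 1)
        ≤ n / (2 ^ 29 * 3 ^ 5 * (p : ℝ) ^ 16)
            - (⌈2 * Real.logb 2 n⌉ : ℝ) / (2 ^ 13 * 3 ^ 2 * (p : ℝ) ^ 8) - 2 := by
  refine ⟨fun C hC n p _ _ hn => ?_, 1 / (2 ^ 29 * 3 ^ 5), by norm_num, 3, by norm_num,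
    fun n p hn hp _ => ?_⟩
  · have hp : (1 : ℝ) ≤ p := by exact_mod_cast NeZero.one_le
    have hn1 : (1 : ℝ) ≤ n := by exact_mod_cast NeZero.one_le
    have hlog : 0 ≤ Real.logb 2 n := Real.logb_nonneg (by norm_num) hn1
    have hceil : (0 : ℝ) ≤ ⌈2 * Real.logb 2 n⌉ := by exact_mod_cast Int.ceil_nonneg (by positivity)
    have hbound : n / (2 ^ 29 * 3 ^ 5 * (p : ℝ) ^ 16)
        - (⌈2 * Real.logb 2 n⌉ : ℝ) / (2 ^ 13 * 3 ^ 2 * (p : ℝ) ^ 8) - 2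
        ≤ n / (64 * (p : ℝ) ^ 2) := by
      have h1 : (n : ℝ) / (2 ^ 29 * 3 ^ 5 * (p : ℝ) ^ 16) ≤ n / (64 * (p : ℝ) ^ 2) := by
        gcongr <;> norm_num [hp]
      have h2 : 0 ≤ (⌈2 * Real.logb 2 n⌉ : ℝ) / (2 ^ 13 * 3 ^ 2 * (p : ℝ) ^ 8) := by positivity
      linarith
    have hdist : ENNReal.ofReal (n / (64 * (p : ℝ) ^ 2))
        ≤ distInformationComplexity (p - 1) (lpce n p (C * (1 + Real.logb 2 n)))
          (PMF.uniformOfFintype (Fin (2 * p) → Fin n → Fin n)) (1 / (64 * (n : ℝ≥0∞))) :=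
      le_iInf₂ fun P hP => (P.lt_informationCost_of_avgErrorProb_le hC hn hP).le
    have hE : ∀ I : ℝ≥0∞, ENNReal.ofReal (n / (64 * (p : ℝ) ^ 2)) ≤ I →
        ((n / (2 ^ 29 * 3 ^ 5 * (p : ℝ) ^ 16)
            - (⌈2 * Real.logb 2 n⌉ : ℝ) / (2 ^ 13 * 3 ^ 2 * (p : ℝ) ^ 8) - 2 : ℝ) : EReal)
          ≤ (I : EReal) := by
      intro I hI
      refine le_trans ?_ (EReal.coe_ennreal_le_coe_ennreal_iff.2 hI)
      rw [EReal.coe_ennreal_ofReal]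
      exact EReal.coe_le_coe_iff.2 (hbound.trans (le_max_left _ _))
    exact ⟨hE _ (hdist.trans (distInformationComplexity_le_informationComplexity _ _ _ _)),
      hE _ hdist⟩
  · have hp1 : (1 : ℝ) ≤ p := by exact_mod_cast hp
    have hn1 : (1 : ℝ) ≤ n := by exact_mod_cast hn
    have hlog : 0 ≤ Real.logb 2 n := Real.logb_nonneg (by norm_num) hn1
    have hceil : (⌈2 * Real.logb 2 n⌉ : ℝ) ≤ 2 * Real.logb 2 n + 1 := (Int.ceil_lt_add_one _).le
    have hp8 : (1 : ℝ) ≤ (p : ℝ) ^ 8 := one_le_pow₀ hp1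
    have h1 : (⌈2 * Real.logb 2 n⌉ : ℝ) / (2 ^ 13 * 3 ^ 2 * (p : ℝ) ^ 8)
        ≤ 3 * (Real.logb 2 n / (p : ℝ) ^ 8) + 1 := by
      rw [div_le_iff₀ (by positivity)]
      have h2 : Real.logb 2 n / (p : ℝ) ^ 8 * (p : ℝ) ^ 8 = Real.logb 2 n :=
        div_mul_cancel₀ _ (by positivity)
      nlinarith
    have h3 : 1 / (2 ^ 29 * 3 ^ 5) * (n / (p : ℝ) ^ 16) = n / (2 ^ 29 * 3 ^ 5 * (p : ℝ) ^ 16) := by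
      field_simp
    linarith
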